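/- **Conventions.** An algorithm, for inputs of a given size, is a randomized Boolean circuit (a straight-line program over all Boolean gates of fan-in two) whose input bits are the bits of arbitrarily many i.i.d. samples (spins $\pm1$ coded as bits) and arbitrarily many fair coin flips. Its running time is its number of gates plus its number of output bits. *Sparse parity with noise.* For $\eta\in(0,1/2)$ and $S\subseteq[n]$, let $P_{S,\eta}$ be the law of $(X,Y)$ where $X\sim\mathrm{Unif}(\{\pm1\}^n)$ and, given $X$, $Y=\prod_{s\in S}X_s$ with probability $1/2+\eta$ and $Y=-\prod_{s\in S}X_s$ with probability $1/2-\eta$. An algorithm solves the $k$-sparse parity with noise problem if, for every $S$ with $|S|=k$, it tests $\mathrm{Unif}(\{\pm1\}^{n+1})$ against $P_{S,\eta}$ with Type I and Type II error probabilities of sum at most $0.01$. *Hardness of sparse parity with noise of bias $\eta$* is the assumption that for every sequence $k_n$ of positive integers with $k_n=o(n^{1-\epsilon})$ for some $\epsilon>0$ there is $c>0$ such that, for all sufficiently large $n$, every algorithm solving the $k_n$-sparse parity with noise problem has running time at least $n^{ck_n}$. *RBMs.* An RBM with $n_1$ visible and $n_2$ hidden units, with parameters $W\in\mathbb R^{n_1\times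 n_2}$, $b^{(1)}\in\mathbb R^{n_1}$, $b^{(2)}\in\mathbb R^{n_2}$, is the law $\Pr(X=x,H=h)\propto\exp(\langle x,Wh\rangle+\langle b^{(1)},x\rangle+\langle b^{(2)},h\rangle)$ on $\{\pm1\}^{n_1}\times\{\pm1\}^{n_2}$; its distribution is the marginal law of $X$. The degree of hidden unit $j$ is $|\{i:W_{ij}\ne0\}|$. The RBM is $(\lambda_1,\lambda_2)$-bounded if $\sum_j|\tanh W_{ij}|+|b^{(1)}_i|\le\lambda_1$ for every $i$ and $\sum_i|W_{ij}|\le\lambda_2$ for every $j$. *Learning.* A learner consists of an algorithm that reads samples and coin flips and outputs a hypothesis (a bit string), together with a circuit that computes from a hypothesis and a point $x\in\{\pm1\}^n$ the unnormalized probability mass of $x$ under the hypothesis, a nonnegative integer in binary. Its running time is the sum of the two running times. It learns a family of RBMs within total variation distance $\delta$ if, for every RBM in the family, given i.i.d. samples of the visible units, with probability at least $2/3$ its hypothesis has positive total mass and its normalization is within total variation distance $\delta$ of the distribution of the RBM. **Theorem.** There are absolute constants $\lambda_1,\lambda_2$ and families $\mathcal F_{n,d}$ of $(\lambda_1,\lambda_2)$-bounded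 RBMs with $n$ visible units, at most $n$ hidden units and maximum hidden degree $d_H=d$, such that the following holds. Let $\eta\in(0,1/2)$ and assume hardness of sparse parity with noise of bias $\eta$. Then there is a constant $c>0$ (depending only on $\eta$, not on $d$) such that for every $d\ge2$ and all sufficiently large $n$ (depending on $d$), every learner which learns $\mathcal F_{n,d}$ within total variation distance $1/4$ has running time at least $n^{cd}$, whatever its number of samples. That is, learning these RBMs to total variation distance $1/4$ requires time $n^{\Omega(d_H)}$, although $\lambda_1,\lambda_2=O(1)$; no nondegeneracy condition is imposed on the RBMs. -/

import Mathlib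

open Filter Asymptotics

noncomputable section

namespace RBMHardness

/-! ### Distributions on spins

A spin configuration indexed by `κ` is a function `κ → Bool`; the Boolean `true` stands for the
spin `+1` and `false` for the spin `-1`. -/

/-- The spin `±1` encoded by a Boolean. -/
def spin (b : Bool) : ℝ := if b then 1 else -1

/-- Total variation distance between two probability mass functions on a finite set. -/
def tvDist {α : Type} [Fintype α] (p q : α → ℝ) : ℝ :=
  (1 / 2) * ∑ a, |p a - q a|

open Classical in
/-- Probability that the event `A` occurs, when `A` depends on `m` i.i.d. samples from the
probability mass function `p` and on `r` independent fair coin flips. -/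
def prob {α : Type} [Fintype α] (p : α → ℝ) (m r : ℕ)
    (A : (Fin m → α) → (Fin r → Bool) → Prop) : ℝ :=
  ∑ s : Fin m → α, ∑ u : Fin r → Bool,
    if A s u then (∏ i, p (s i)) * (1 / 2 : ℝ) ^ r else 0

/-! ### Model of computation: randomized Boolean circuits -/

/-- Boolean circuits (straight-line programs) with input bits indexed by `ι` and output bits
indexed by `ω`. Either the output bits are read off from the available wires, or one more gate
(an arbitrary Boolean function of two available wires) is computed; its value is then available
as the new wire `none`, next to the old wires `some i`. -/
inductive Circuit (ω : Type) : Type → Type 1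
  | output {ι : Type} (out : ω → ι) : Circuit ω ι
  | gate {ι : Type} (f : Bool → Bool → Bool) (a b : ι) (rest : Circuit ω (Option ι)) :
      Circuit ω ι

/-- The output bits that a circuit computes on given input bits. -/
def Circuit.eval {ω : Type} : {ι : Type} → Circuit ω ι → (ι → Bool) → ω → Bool
  | _, .output out, x => fun o => x (out o)
  | _, .gate f a b rest, x => rest.eval (fun w => w.elim (f (x a) (x b)) x)

/-- Number of gates of a circuit. -/
def Circuit.gates {ω : Type} : {ι : Type} → Circuit ω ι → ℕ
  | _, .output _ => 0
  | _, .gate _ _ _ rest => rest.gates + 1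

/-- Running time: one step for every gate and one step for every output bit. -/
def Circuit.time {ω : Type} [Fintype ω] {ι : Type} (C : Circuit ω ι) : ℕ :=
  C.gates + Fintype.card ω

/-! ### Sparse parity with noise -/

/-- A sample `(X, Y)` with `X ∈ {±1}^n` and `Y ∈ {±1}`: the bit `some i` is `X i`, the bit
`none` is `Y`. -/
abbrev LabeledSample (n : ℕ) : Type := Option (Fin n) → Bool

/-- Law of the parity with noise on `S`: `X` is uniform, and `Y = ∏ s ∈ S, X s` with probability
`1/2 + η`, `Y = -∏ s ∈ S, X s` with probability `1/2 - η`. -/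
def sparseParity {n : ℕ} (η : ℝ) (S : Finset (Fin n)) (z : LabeledSample n) : ℝ :=
  (1 / 2) ^ n *
    (if spin (z none) = ∏ s ∈ S, spin (z (some s)) then 1 / 2 + η else 1 / 2 - η)

/-- The uniform distribution of `(X, Y)`. -/
def uniformLabeled (n : ℕ) (_ : LabeledSample n) : ℝ := (1 / 2) ^ (n + 1)

/-- A randomized algorithm which reads `samples` samples `(X, Y)` and `coins` fair coin flips and
answers with one bit (`true`: parity with noise, `false`: uniform). -/
structure Tester (n : ℕ) where
  samples : ℕ
  coins : ℕ
  circuit : Circuit Unit ((Fin samples × Option (Fin n)) ⊕ Fin coins)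

/-- The answer of a tester. -/
def Tester.answer {n : ℕ} (A : Tester n) (s : Fin A.samples → LabeledSample n)
    (u : Fin A.coins → Bool) : Bool :=
  A.circuit.eval (Sum.elim (fun q => s q.1 q.2) u) ()

/-- Running time of a tester. -/
def Tester.time {n : ℕ} (A : Tester n) : ℕ := A.circuit.time

/-- The tester solves the `k`-sparse parity with noise problem: for every unknown set `S` of size
`k`, the probabilities of Type I and Type II errors add up to at most `0.01`. -/
def Tester.Solves {n : ℕ} (A : Tester n) (η : ℝ) (k : ℕ) : Prop :=
  ∀ S : Finset (Fin n), S.card = k →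
    prob (uniformLabeled n) A.samples A.coins (fun s u => A.answer s u = true) +
      prob (sparseParity η S) A.samples A.coins (fun s u => A.answer s u = false) ≤ 0.01

/-- Hardness of learning sparse parity with noise of bias `η`: for all positive integers `k n`
with `k n = o(n ^ (1 - ε))` for some `ε > 0`, solving the `k n`-sparse parity with noise problem
needs time `n ^ Ω(k n)`. -/
def SparseParityHard (η : ℝ) : Prop :=
  ∀ ε : ℝ, 0 < ε → ∀ k : ℕ → ℕ, (∀ n, 1 ≤ k n) →
    (fun n : ℕ => (k n : ℝ)) =o[atTop] (fun n : ℕ => (n : ℝ) ^ (1 - ε)) →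
    ∃ c : ℝ, 0 < c ∧ ∀ᶠ n : ℕ in atTop, ∀ A : Tester n, A.Solves η (k n) →
      (n : ℝ) ^ (c * (k n : ℝ)) ≤ (A.time : ℝ)

/-! ### Restricted Boltzmann machines -/

/-- Parameters of a restricted Boltzmann machine with `n₁` visible and `n₂` hidden units. -/
structure RBM (n₁ n₂ : ℕ) where
  W : Matrix (Fin n₁) (Fin n₂) ℝ
  b₁ : Fin n₁ → ℝ
  b₂ : Fin n₂ → ℝ

namespace RBM

variable {n₁ n₂ : ℕ}

/-- Unnormalized joint weight `exp (⟨x, W h⟩ + ⟨b₁, x⟩ + ⟨b₂, h⟩)`. -/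
def weight (R : RBM n₁ n₂) (x : Fin n₁ → Bool) (h : Fin n₂ → Bool) : ℝ :=
  Real.exp ((∑ i, ∑ j, spin (x i) * R.W i j * spin (h j)) +
    (∑ i, R.b₁ i * spin (x i)) + ∑ j, R.b₂ j * spin (h j))

/-- Distribution of the RBM: the marginal law of the visible units. -/
def marginal (R : RBM n₁ n₂) (x : Fin n₁ → Bool) : ℝ :=
  (∑ h, R.weight x h) / ∑ x', ∑ h, R.weight x' h

/-- Degree of the hidden unit `j`: the number of visible units that it is joined to. -/
def hiddenDegree (R : RBM n₁ n₂) (j : Fin n₂) : ℕ := {i | R.W i j ≠ 0}.ncard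

/-- Maximum degree of a hidden unit. -/
def maxHiddenDegree (R : RBM n₁ n₂) : ℕ := Finset.univ.sup R.hiddenDegree

/-- The RBM is `(lam₁, lam₂)`-bounded. -/
def Bounded (R : RBM n₁ n₂) (lam₁ lam₂ : ℝ) : Prop :=
  (∀ i, (∑ j, |Real.tanh (R.W i j)|) + |R.b₁ i| ≤ lam₁) ∧ ∀ j, ∑ i, |R.W i j| ≤ lam₂

end RBM

/-! ### Learning in total variation distance -/

/-- The natural number with the given binary digits. -/
def binaryValue {l : ℕ} (v : Fin l → Bool) : ℕ := ∑ i, (v i).toNat * 2 ^ (i : ℕ)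

/-- A randomized distribution learner on `{±1}^n`. The circuit `learn` reads `samples` samples and
`coins` fair coin flips and writes down a hypothesis, a bit string of length `hypLen`. The circuit
`evaluate` computes from a hypothesis and a point `x` the unnormalized probability mass which the
hypothesis gives to `x`, a natural number in binary. -/
structure Learner (n : ℕ) where
  samples : ℕ
  coins : ℕ
  hypLen : ℕ
  valLen : ℕ
  learn : Circuit (Fin hypLen) ((Fin samples × Fin n) ⊕ Fin coins)
  evaluate : Circuit (Fin valLen) (Fin hypLen ⊕ Fin n)

namespace Learner

variable {n : ℕ}

/-- Running time of a learner: learning and evaluating the learned mass function at a point. -/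
def time (L : Learner n) : ℕ := L.learn.time + L.evaluate.time

/-- The hypothesis which the learner writes down. -/
def hypothesis (L : Learner n) (s : Fin L.samples → Fin n → Bool) (u : Fin L.coins → Bool) :
    Fin L.hypLen → Bool :=
  L.learn.eval (Sum.elim (fun q => s q.1 q.2) u)

/-- Unnormalized mass which the hypothesis `w` gives to the point `x`. -/
def mass (L : Learner n) (w : Fin L.hypLen → Bool) (x : Fin n → Bool) : ℝ :=
  (binaryValue (L.evaluate.eval (Sum.elim w x)) : ℝ)

/-- The probability mass function described by the hypothesis `w`. -/
def density (L : Learner n) (w : Fin L.hypLen → Bool) (x : Fin n → Bool) : ℝ :=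
  L.mass w x / ∑ x', L.mass w x'

/-- The learner learns the distribution `p` within total variation distance `δ`: with probability
at least `2/3`, its hypothesis describes a probability distribution at distance at most `δ`
from `p`. -/
def LearnsDist (L : Learner n) (p : (Fin n → Bool) → ℝ) (δ : ℝ) : Prop :=
  2 / 3 ≤ prob p L.samples L.coins (fun s u =>
    0 < ∑ x, L.mass (L.hypothesis s u) x ∧ tvDist (L.density (L.hypothesis s u)) p ≤ δ)

/-- The learner learns every RBM of the family `F` within total variation distance `δ`. -/
def Learns (L : Learner n) (F : Set (Σ n₂ : ℕ, RBM n n₂)) (δ : ℝ) : Prop :=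
  ∀ R ∈ F, L.LearnsDist R.2.marginal δ

end Learner

end RBMHardness

end

noncomputable section

namespace RBMHardness

/-! The proof turns a learner into a tester for `k`-sparse parity with noise, where `k = d - 1`.
Join the `k` bits `z i` of `S` and the label `w` to one hidden unit for every sign pattern `τ` on
`S`, with weights `a * τ i` on the bits, `a' * ∏ τ i` on the label, and bias `b`. Summing out these
units leaves `∏ τ, cosh (a * ∑ τ i * z i + a' * w * ∏ τ i + b)` up to a constant. The substitution
`τ i ↦ τ i * z i` shows that this depends only on `w * ∏ z i` (`prod_cosh_eq_parityFactor`), so the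
visible law is exactly a parity with noise (`marginal_parityRBM`).

The weights may be as small as boundedness demands, because the biases of hidden units are not
restricted. For `a' = a` the log-ratio of the two values of the product is an iterated central
difference of `log ∘ cosh` at `b`, and this is nonzero for some `b`
(`exists_iterate_centralDiff_ne_zero`). Varying `a'` then tunes the noise bias to some `η / 2 ^ s`
(`exists_parityBias_eq`), a bias which samples of bias `η` can be degraded to with coins. It may be
tiny, but it does not depend on `n`, so a constant number of independent blocks is far from uniform
in total variation (`le_tvDist_blockLaw`).

A good hypothesis is therefore also far from uniform, and a data point tends to have larger
hypothesis mass than a uniform point; no normalizing constant is needed for this comparison. If the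
data are uniform, symmetry makes the comparison fair for every hypothesis. Constantly many
repetitions give a tester slower than the learner by a constant factor (`exists_tester_of_learner`).

The hardness assumption provides an exponent for each sequence of sparsities. A diagonal sequence
makes it uniform in `k` (`SparseParityHard.exists_not_frequently`). -/

/-! ### Gate counts for families of Boolean functions -/

/-- `Cost G B n`: with at most `n` gates, all Boolean functions in `G` can be computed from the
Boolean functions in `B`. -/
inductive Cost {X : Type} (G : Set (X → Bool)) : Set (X → Bool) → ℕ → Prop
  | done {B : Set (X → Bool)} (n : ℕ) (h : G ⊆ B) : Cost G B n
  | gate {B : Set (X → Bool)} {n : ℕ} (f : Bool → Bool → Bool) {a b : X → Bool}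
      (ha : a ∈ B) (hb : b ∈ B) (h : Cost G (insert (fun x => f (a x) (b x)) B) n) :
      Cost G B (n + 1)

namespace Cost

variable {X X' : Type} {G H B D : Set (X → Bool)} {n m K : ℕ}

theorem mono_num (h : Cost G B n) : ∀ {m : ℕ}, n ≤ m → Cost G B m := by
  induction h with
  | done n h => intro m _; exact done m h
  | gate f ha hb _ ih =>
    intro m hm
    obtain ⟨l, rfl⟩ : ∃ l, m = l + 1 := ⟨m - 1, by omega⟩
    exact gate f ha hb (ih (by omega))

theorem mono_base (h : Cost G B n) : ∀ {D : Set (X → Bool)}, B ⊆ D → Cost G D n := by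
  induction h with
  | done n h => intro D hD; exact done n (h.trans hD)
  | gate f ha hb _ ih =>
    intro D hD
    exact gate f (hD ha) (hD hb) (ih (Set.insert_subset_insert hD))

theorem mono_goal (h : Cost G B n) (hH : H ⊆ G) : Cost H B n := by
  induction h with
  | done n h => exact done n (hH.trans h)
  | gate f ha hb _ ih => exact gate f ha hb ih

/-- Functions that are available may be added to the goal. -/
theorem frame (h : Cost G B n) : ∀ {F : Set (X → Bool)}, F ⊆ B → Cost (G ∪ F) B n := by
  induction h with
  | done n h => intro F hF; exact done n (Set.union_subset h hF)
  | gate f ha hb _ ih =>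
    intro F hF
    exact gate f ha hb (ih (hF.trans (Set.subset_insert _ _)))

/-- Computed functions stay available, so gate counts add and intermediate results are shared. This
is what lets one hypothesis serve many evaluations. -/
theorem trans (h : Cost G B n) : ∀ {m : ℕ}, Cost H (B ∪ G) m → Cost H B (n + m) := by
  induction h with
  | @done B n h =>
    intro m hH
    rw [Set.union_eq_self_of_subset_right h] at hH
    exact hH.mono_num (by omega)
  | @gate B n f a b ha hb _ ih =>
    intro m hH
    rw [Nat.add_right_comm]
    exact gate f ha hb (ih (hH.mono_base (Set.union_subset_union_left _ (Set.subset_insert _ _))))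

theorem union (h : Cost G B n) (h' : Cost H B m) : Cost (G ∪ H) B (n + m) := by
  refine h.trans ?_
  rw [Set.union_comm G]
  exact (h'.mono_base Set.subset_union_left).frame Set.subset_union_right

theorem biUnion {ι : Type} (s : Finset ι) (G : ι → Set (X → Bool))
    (h : ∀ i ∈ s, Cost (G i) B K) : Cost (⋃ i ∈ s, G i) B (s.card * K) := by
  classical
  induction s using Finset.induction_on with
  | empty => exact done _ (by simp)
  | insert i s hi ih =>
    rw [Finset.card_insert_of_notMem hi, Finset.set_biUnion_insert, Nat.succ_mul, Nat.add_comm]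
    exact (h i (by simp)).union (ih fun j hj => h j (by simp [hj]))

theorem iUnion {ι : Type} [Fintype ι] (G : ι → Set (X → Bool))
    (h : ∀ i, Cost (G i) B K) : Cost (⋃ i, G i) B (Fintype.card ι * K) := by
  simpa using biUnion Finset.univ G (fun i _ => h i)

theorem of_mem {a : X → Bool} (ha : a ∈ B) : Cost {a} B n := done n (by simpa using ha)

theorem gate_of {a b : X → Bool} (f : Bool → Bool → Bool) (ha : Cost {a} B n)
    (hb : Cost {b} B m) : Cost {fun x => f (a x) (b x)} B (n + m + 1) :=
  (ha.union hb).trans (gate f (a := a) (b := b) (by simp) (by simp) (of_mem (by simp)))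

/-- Substitution: if every function in the base costs at most `K` gates after composition with
`φ`, then so does every computed function, with the gate count multiplied. -/
theorem subst {φ : X' → X} (h : Cost G B n) : ∀ {D : Set (X' → Bool)},
    (∀ b ∈ B, Cost {b ∘ φ} D K) → ∀ g ∈ G, Cost {g ∘ φ} D ((2 * K + 1) * n + K) := by
  induction h with
  | done n h => intro D hD g hg; exact (hD g (h hg)).mono_num (by omega)
  | @gate B n f a b ha hb _ ih =>
    intro D hD g hg
    -- The inputs of every gate are recomputed from scratch, at `2 * K + 1` gates, so no
    -- intermediate family has to be tracked. Only a constant factor is lost.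
    have h1 : Cost {fun x => f ((a ∘ φ) x) ((b ∘ φ) x)} D (K + K + 1) :=
      gate_of f (hD a ha) (hD b hb)
    refine (h1.trans (ih ?_ g hg)).mono_num (by ring_nf; omega)
    rintro c (rfl | hc)
    · exact of_mem (Or.inr rfl)
    · exact (hD c hc).mono_base Set.subset_union_left

theorem comp {φ : X' → X} (h : Cost G B n) {D : Set (X' → Bool)} (hD : ∀ b ∈ B, b ∘ φ ∈ D)
    (g : X → Bool) (hg : g ∈ G) : Cost {g ∘ φ} D n := by
  simpa using h.subst (K := 0) (fun b hb => of_mem (hD b hb)) g hg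

/-- The functions computed by a circuit. -/
theorem of_circuit {ω ι : Type} (C : Circuit ω ι) : ∀ {B : Set (X → Bool)} (ρ : ι → X → Bool),
    (∀ i, ρ i ∈ B) → Cost (Set.range fun o x => C.eval (fun i => ρ i x) o) B C.gates := by
  induction C with
  | output out =>
    intro B ρ hρ
    refine done _ ?_
    rintro _ ⟨o, rfl⟩
    exact hρ _
  | @gate ι f a b rest ih =>
    intro B ρ hρ
    refine gate f (hρ a) (hρ b) ?_
    have := ih (B := insert (fun x => f (ρ a x) (ρ b x)) B)
      (fun w => w.elim (fun x => f (ρ a x) (ρ b x)) ρ) (by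
        rintro (_ | i)
        · exact Set.mem_insert _ _
        · exact Set.mem_insert_of_mem _ (hρ i))
    convert this using 5 with o x
    simp only [Circuit.eval]
    congr 1
    funext w
    cases w <;> rfl

/-- A circuit for a family of functions. -/
theorem exists_circuit {ω : Type} (h : Cost G B n) : ∀ {ι : Type} (ρ : ι → X → Bool)
    (_ : B ⊆ Set.range ρ) (out : ω → X → Bool) (_ : ∀ o, out o ∈ G),
    ∃ C : Circuit ω ι, C.gates ≤ n ∧ ∀ x o, C.eval (fun i => ρ i x) o = out o x := by
  induction h with
  | done n h =>
    intro ι ρ hρ out hout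
    choose i hi using fun o => hρ (h (hout o))
    exact ⟨.output i, Nat.zero_le _, fun x o => by simp [Circuit.eval, hi]⟩
  | @gate B n f a b ha hb _ ih =>
    intro ι ρ hρ out hout
    obtain ⟨i, rfl⟩ := hρ ha
    obtain ⟨j, rfl⟩ := hρ hb
    obtain ⟨C, hC, hE⟩ := ih (fun w : Option ι => w.elim (fun x => f (ρ i x) (ρ j x)) ρ) (by
      rintro c (rfl | hc)
      · exact ⟨none, rfl⟩
      · obtain ⟨l, rfl⟩ := hρ hc
        exact ⟨some l, rfl⟩) out hout
    refine ⟨.gate f i j C, by simpa [Circuit.gates] using hC, fun x o => ?_⟩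
    rw [← hE]
    simp only [Circuit.eval]
    congr 1
    funext w
    cases w <;> rfl

/-- The conjunction of finitely many functions. -/
theorem all {ι : Type} [Fintype ι] [Nonempty ι] (a : ι → X → Bool) (h : ∀ i, a i ∈ B)
    [∀ x, Decidable (∀ i, a i x = true)] :
    Cost {fun x => decide (∀ i, a i x = true)} B (Fintype.card ι + 1) := by
  classical
  obtain ⟨i₀⟩ := ‹Nonempty ι›
  have key : ∀ s : Finset ι, Cost {fun x => decide (∀ i ∈ s, a i x = true)} B (s.card + 1) := by
    intro s
    induction s using Finset.induction_on with
    | empty =>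
      exact (gate_of (fun _ _ => true) (of_mem (n := 0) (h i₀))
        (of_mem (n := 0) (h i₀))).mono_goal (by simp)
    | insert i s hi ih =>
      rw [Finset.card_insert_of_notMem hi]
      convert (gate_of and (of_mem (n := 0) (h i)) ih).mono_num (m := s.card + 1 + 1) (by omega)
        using 3
      simp
  convert key Finset.univ using 4 <;> simp

/-- The disjunction of finitely many functions. -/
theorem any {ι : Type} [Fintype ι] [Nonempty ι] (a : ι → X → Bool) (h : ∀ i, a i ∈ B)
    [∀ x, Decidable (∃ i, a i x = true)] :
    Cost {fun x => decide (∃ i, a i x = true)} B (Fintype.card ι + 1) := by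
  classical
  obtain ⟨i₀⟩ := ‹Nonempty ι›
  have key : ∀ s : Finset ι, Cost {fun x => decide (∃ i ∈ s, a i x = true)} B (s.card + 1) := by
    intro s
    induction s using Finset.induction_on with
    | empty =>
      exact (gate_of (fun _ _ => false) (of_mem (n := 0) (h i₀))
        (of_mem (n := 0) (h i₀))).mono_goal (by simp)
    | insert i s hi ih =>
      rw [Finset.card_insert_of_notMem hi]
      convert (gate_of or (of_mem (n := 0) (h i)) ih).mono_num (m := s.card + 1 + 1) (by omega)
        using 3
      simp
  convert key Finset.univ using 4 <;> simp

/-- Choosing between two functions. -/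
theorem mux {c a b : X → Bool} (hc : c ∈ B) (ha : a ∈ B) (hb : b ∈ B) :
    Cost {fun x => if c x = true then a x else b x} B 3 := by
  have := gate_of or (gate_of and (of_mem (n := 0) hc) (of_mem (n := 0) ha))
    (gate_of (fun c b => !c && b) (of_mem (n := 0) hc) (of_mem (n := 0) hb))
  convert this using 3 with x
  cases c x <;> simp

end Cost

/-! ### Comparing binary numbers -/

/-- Comparison of the binary numbers `a` and `b`, with the answer `t` in the case of a tie. -/
def compareBits : (l : ℕ) → (Fin l → Bool) → (Fin l → Bool) → Bool → Bool
  | 0, _, _, t => t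
  | l + 1, a, b, t =>
    (a (Fin.last l) && !b (Fin.last l)) ||
      (compareBits l (fun i => a i.castSucc) (fun i => b i.castSucc) t &&
        (a (Fin.last l) || !b (Fin.last l)))

theorem binaryValue_succ {l : ℕ} (v : Fin (l + 1) → Bool) :
    binaryValue v = binaryValue (fun i => v i.castSucc) + (v (Fin.last l)).toNat * 2 ^ l := by
  simp [binaryValue, Fin.sum_univ_castSucc]

theorem binaryValue_lt {l : ℕ} (v : Fin l → Bool) : binaryValue v < 2 ^ l := by
  induction l with
  | zero => simp [binaryValue]
  | succ l ih =>
    rw [binaryValue_succ, pow_succ]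
    have := ih (fun i => v i.castSucc)
    cases v (Fin.last l) <;> simp <;> omega

theorem compareBits_eq_true {l : ℕ} (a b : Fin l → Bool) (t : Bool) :
    compareBits l a b t = true ↔
      binaryValue b < binaryValue a ∨ (binaryValue a = binaryValue b ∧ t = true) := by
  induction l with
  | zero => simp [compareBits, binaryValue]
  | succ l ih =>
    have ha := binaryValue_lt (fun i => a i.castSucc)
    have hb := binaryValue_lt (fun i => b i.castSucc)
    rw [binaryValue_succ a, binaryValue_succ b, compareBits]
    have := ih (fun i => a i.castSucc) (fun i => b i.castSucc)
    cases a (Fin.last l) <;> cases b (Fin.last l) <;> simp [this] <;> omega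

theorem Cost.compareBits {X : Type} {B : Set (X → Bool)} {l : ℕ} (a b : Fin l → X → Bool)
    (t : X → Bool) (ha : ∀ i, a i ∈ B) (hb : ∀ i, b i ∈ B) (ht : t ∈ B) :
    Cost {fun x => compareBits l (fun i => a i x) (fun i => b i x) (t x)} B (4 * l) := by
  induction l with
  | zero => exact of_mem ht
  | succ l ih =>
    have h1 := ih (fun i => a i.castSucc) (fun i => b i.castSucc) (fun i => ha _) (fun i => hb _)
    have h2 := gate_of or
      (gate_of (fun p q => p && !q) (of_mem (n := 0) (ha (Fin.last l)))
        (of_mem (n := 0) (hb (Fin.last l))))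
      (gate_of and h1 (gate_of (fun p q => p || !q) (of_mem (n := 0) (ha (Fin.last l)))
        (of_mem (n := 0) (hb (Fin.last l)))))
    exact h2.mono_num (by omega)

/-! ### Laws of random variables on finite weighted spaces -/

/-- The variable `g` has law `q` when the outcomes are weighted by `w`. -/
def HasLaw {Ω β : Type} [Fintype Ω] [Fintype β] (w : Ω → ℝ) (g : Ω → β) (q : β → ℝ) : Prop :=
  ∀ f : β → ℝ, ∑ x, w x * f (g x) = ∑ b, q b * f b

open Classical in
/-- The law of the variable `g`. -/
def law {Ω β : Type} [Fintype Ω] (w : Ω → ℝ) (g : Ω → β) (b : β) : ℝ :=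
  ∑ x, if g x = b then w x else 0

section Law

variable {Ω Ω' β γ : Type} [Fintype Ω] [Fintype Ω'] [Fintype β] [Fintype γ]

theorem hasLaw_law (w : Ω → ℝ) (g : Ω → β) : HasLaw w g (law w g) := by
  classical
  intro f
  simp only [law, Finset.sum_mul]
  rw [Finset.sum_comm]
  simp [ite_mul]

theorem HasLaw.law_eq {w : Ω → ℝ} {g : Ω → β} {q : β → ℝ} (h : HasLaw w g q) : law w g = q := by
  classical
  funext b
  have := h (fun c => if c = b then 1 else 0)
  simpa [law] using this

theorem HasLaw.comp {w : Ω → ℝ} {g : Ω → β} {q : β → ℝ} {h : β → γ} {r : γ → ℝ}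
    (hg : HasLaw w g q) (hh : HasLaw q h r) : HasLaw w (h ∘ g) r := fun f =>
  (hg (f ∘ h)).trans (hh f)

theorem hasLaw_equiv (e : Ω ≃ β) (q : β → ℝ) : HasLaw (q ∘ e) e q := fun f =>
  e.sum_comp fun b => q b * f b

theorem HasLaw.prod {w : Ω → ℝ} {w' : Ω' → ℝ} {g : Ω → β} {g' : Ω' → γ} {q : β → ℝ} {r : γ → ℝ}
    (h : HasLaw w g q) (h' : HasLaw w' g' r) :
    HasLaw (fun x : Ω × Ω' => w x.1 * w' x.2) (Prod.map g g') (fun x => q x.1 * r x.2) := by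
  intro f
  simp only [Fintype.sum_prod_type, mul_assoc, ← Finset.mul_sum, Prod.map]
  rw [← h fun b => ∑ c, r c * f (b, c)]
  refine Finset.sum_congr rfl fun x _ => ?_
  rw [h' fun c => f (g x, c)]

/-- It suffices to compare atoms, where the sum over outcomes factors over the coordinates. -/
theorem HasLaw.pi {ι : Type} [Fintype ι] [DecidableEq ι] {w : Ω → ℝ} {g : Ω → β} {q : β → ℝ}
    (h : HasLaw w g q) :
    HasLaw (fun x : ι → Ω => ∏ i, w (x i)) (fun x i => g (x i)) (fun b => ∏ i, q (b i)) := by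
  classical
  have hl : law (fun x : ι → Ω => ∏ i, w (x i)) (fun x i => g (x i)) = fun b => ∏ i, q (b i) := by
    funext b
    simp only [law, ← h.law_eq]
    rw [Finset.prod_univ_sum, Fintype.piFinset_univ]
    refine Finset.sum_congr rfl fun x _ => ?_
    rw [Finset.prod_ite_zero]
    simp [funext_iff]
  rw [← hl]
  exact hasLaw_law _ _

end Law

/-! ### Simulating laws from samples and coins -/

section Sim

/-- Weight of an outcome of i.i.d. samples from `p` and fair coins. -/
def sampleWeight {I J α : Type} [Fintype I] [Fintype J] (p : α → ℝ) (x : (I → α) × (J → Bool)) :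
    ℝ :=
  (∏ i, p (x.1 i)) * ∏ _j : J, (1 / 2 : ℝ)

/-- The bits of the samples and the coins. -/
def inputBit {I J κ : Type} : (I × κ) ⊕ J → (I → κ → Bool) × (J → Bool) → Bool
  | .inl q => fun x => x.1 q.1 q.2
  | .inr j => fun x => x.2 j

/-- From i.i.d. samples of the law `p θ`, whose number does not depend on `θ`, and fair coins one
obtains a variable of law `q θ`, and each of its bits in `B` costs at most `K` gates. -/
def Sim {Θ κ β : Type} [Fintype κ] [DecidableEq κ] [Fintype β] (p : Θ → (κ → Bool) → ℝ)
    (q : Θ → β → ℝ) (B : Set (β → Bool)) (K : ℕ) : Prop :=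
  ∃ (I J : Type) (_ : Fintype I) (_ : DecidableEq I) (_ : Fintype J) (_ : DecidableEq J)
    (g : (I → κ → Bool) × (J → Bool) → β),
    (∀ θ, HasLaw (sampleWeight (p θ)) g (q θ)) ∧
      ∀ b ∈ B, Cost {b ∘ g} (Set.range (inputBit (I := I) (J := J) (κ := κ))) K

variable {Θ κ β γ : Type} [Fintype κ] [DecidableEq κ] [Fintype β] [Fintype γ]
  {p : Θ → (κ → Bool) → ℝ} {q : Θ → β → ℝ} {r : Θ → γ → ℝ} {B : Set (β → Bool)}
  {D : Set (γ → Bool)} {K n : ℕ}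

theorem Sim.mono (h : Sim p q B K) (hD : K ≤ n) : Sim p q B n := by
  obtain ⟨I, J, hI, hI', hJ, hJ', g, hg, hc⟩ := h
  exact ⟨I, J, hI, hI', hJ, hJ', g, hg, fun b hb => (hc b hb).mono_num hD⟩

theorem Sim.sample (p : Θ → (κ → Bool) → ℝ) :
    Sim p p (Set.range fun i (x : κ → Bool) => x i) 0 := by
  refine ⟨Unit, Empty, inferInstance, inferInstance, inferInstance, inferInstance,
    (fun x => x.1 () : (Unit → κ → Bool) × (Empty → Bool) → κ → Bool), fun θ f => ?_, ?_⟩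
  · rw [← (((Equiv.funUnique Unit (κ → Bool)).symm).trans
      (Equiv.prodUnique _ (Empty → Bool)).symm).sum_comp]
    simp [sampleWeight]
  · rintro _ ⟨i, rfl⟩
    exact Cost.of_mem ⟨.inl ((), i), rfl⟩

theorem Sim.coin (p : Θ → (κ → Bool) → ℝ) :
    Sim p (fun _ (_ : Bool) => 1 / 2) {id} 0 := by
  refine ⟨Empty, Unit, inferInstance, inferInstance, inferInstance, inferInstance,
    fun x => x.2 (), fun θ f => ?_, ?_⟩
  · rw [← (((Equiv.funUnique Unit Bool).symm).trans
      (Equiv.uniqueProd _ (Empty → κ → Bool)).symm).sum_comp]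
    simp [sampleWeight]
  · rintro _ rfl
    exact Cost.of_mem ⟨.inr (), rfl⟩

theorem Sim.map (h : Sim p q B K) (φ : β → γ) (hφ : ∀ θ, HasLaw (q θ) φ (r θ))
    (hD : ∀ d ∈ D, Cost {d ∘ φ} B n) : Sim p r D ((2 * K + 1) * n + K) := by
  obtain ⟨I, J, hI, hI', hJ, hJ', g, hg, hc⟩ := h
  exact ⟨I, J, hI, hI', hJ, hJ', φ ∘ g, fun θ => (hg θ).comp (hφ θ),
    fun d hd => (hD d hd).subst hc _ rfl⟩

/-- Reindexing without gates. -/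
theorem Sim.map_bits (h : Sim p q B K) (φ : β → γ) (hφ : ∀ θ, HasLaw (q θ) φ (r θ))
    (hD : ∀ d ∈ D, d ∘ φ ∈ B) : Sim p r D K := by
  simpa using h.map (n := 0) φ hφ fun d hd => Cost.of_mem (hD d hd)

/-- Independence comes from using disjoint sets of samples and coins. The cost bound is per bit, so
it does not grow. -/
theorem Sim.prod (h : Sim p q B K) (h' : Sim p r D K) :
    Sim p (fun θ (x : β × γ) => q θ x.1 * r θ x.2)
      ((fun b x => b x.1) '' B ∪ (fun d x => d x.2) '' D) K := by
  obtain ⟨I, J, hI, hI', hJ, hJ', g, hg, hc⟩ := h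
  obtain ⟨I', J', _, _, _, _, g', hg', hc'⟩ := h'
  let e : (I ⊕ I' → κ → Bool) × (J ⊕ J' → Bool) ≃
      ((I → κ → Bool) × (J → Bool)) × ((I' → κ → Bool) × (J' → Bool)) :=
    ((Equiv.sumArrowEquivProdArrow I I' (κ → Bool)).prodCongr
      (Equiv.sumArrowEquivProdArrow J J' Bool)).trans (Equiv.prodProdProdComm _ _ _ _)
  refine ⟨I ⊕ I', J ⊕ J', inferInstance, inferInstance, inferInstance, inferInstance,
    Prod.map g g' ∘ e, fun θ => ?_, ?_⟩
  · have := (hasLaw_equiv e _).comp ((hg θ).prod (hg' θ))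
    convert this using 1
    funext x
    simp only [sampleWeight, Fintype.prod_sum_type, Function.comp]
    simp only [e, Equiv.trans_apply, Equiv.prodCongr_apply, Prod.map, Equiv.sumArrowEquivProdArrow,
      Equiv.prodProdProdComm, Equiv.coe_fn_mk, Function.comp]
    ring
  · rintro _ (⟨b, hb, rfl⟩ | ⟨d, hd, rfl⟩)
    · refine (hc b hb).comp (φ := fun x => (e x).1) ?_ _ rfl
      rintro _ ⟨y | y, rfl⟩
      · exact ⟨.inl (.inl y.1, y.2), rfl⟩
      · exact ⟨.inr (.inl y), rfl⟩
    · refine (hc' d hd).comp (φ := fun x => (e x).2) ?_ _ rfl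
      rintro _ ⟨y | y, rfl⟩
      · exact ⟨.inl (.inr y.1, y.2), rfl⟩
      · exact ⟨.inr (.inr y), rfl⟩

theorem Sim.pi (ι : Type) [Fintype ι] [DecidableEq ι] (h : Sim p q B K) :
    Sim p (fun θ (x : ι → β) => ∏ i, q θ (x i)) {c | ∃ i, ∃ b ∈ B, c = fun x => b (x i)} K := by
  obtain ⟨I, J, hI, hI', hJ, hJ', g, hg, hc⟩ := h
  let e : (ι × I → κ → Bool) × (ι × J → Bool) ≃ (ι → (I → κ → Bool) × (J → Bool)) :=
    ((Equiv.curry ι I (κ → Bool)).prodCongr (Equiv.curry ι J Bool)).trans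
      (Equiv.arrowProdEquivProdArrow ι (fun _ => I → κ → Bool) (fun _ => J → Bool)).symm
  refine ⟨ι × I, ι × J, inferInstance, inferInstance, inferInstance, inferInstance,
    (fun x i => g (x i)) ∘ e, fun θ => ?_, ?_⟩
  · have := (hasLaw_equiv e _).comp ((hg θ).pi (ι := ι))
    convert this using 1
    funext x
    simp only [sampleWeight, Fintype.prod_prod_type, Function.comp, ← Finset.prod_mul_distrib]
    rfl
  · rintro _ ⟨i, b, hb, rfl⟩
    refine (hc b hb).comp (φ := fun x => e x i) ?_ _ rfl
    rintro _ ⟨y | y, rfl⟩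
    · exact ⟨.inl ((i, y.1), y.2), rfl⟩
    · exact ⟨.inr (i, y), rfl⟩

/-- A simulated bit yields a tester. -/
theorem Sim.exists_tester {n : ℕ} {p : Θ → LabeledSample n → ℝ} {q : Θ → Bool → ℝ}
    (h : Sim p q {id} K) :
    ∃ A : Tester n, A.time ≤ K + 1 ∧
      ∀ θ v, prob (p θ) A.samples A.coins (fun s u => A.answer s u = v) = q θ v := by
  classical
  obtain ⟨I, J, hI, hI', hJ, hJ', g, hg, hc⟩ := h
  let eI := Fintype.equivFin I
  let eJ := Fintype.equivFin J
  obtain ⟨C, hC, hE⟩ := (hc id rfl).exists_circuit (ω := Unit)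
    (ι := (Fin (Fintype.card I) × Option (Fin n)) ⊕ Fin (Fintype.card J))
    (Sum.elim (fun y => inputBit (.inl (eI.symm y.1, y.2))) (fun y => inputBit (.inr (eJ.symm y))))
    (by
      rintro _ ⟨y | y, rfl⟩
      · exact ⟨.inl (eI y.1, y.2), by simp⟩
      · exact ⟨.inr (eJ y), by simp⟩) (fun _ => g) (fun _ => rfl)
  refine ⟨⟨_, _, C⟩, by simpa [Tester.time, Circuit.time] using hC, fun θ v => ?_⟩
  rw [← (hg θ).law_eq]
  let e : (I → LabeledSample n) × (J → Bool) ≃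
      (Fin (Fintype.card I) → LabeledSample n) × (Fin (Fintype.card J) → Bool) :=
    (eI.arrowCongr (Equiv.refl _)).prodCongr (eJ.arrowCongr (Equiv.refl _))
  simp only [prob, law]
  rw [← Fintype.sum_prod_type', ← e.sum_comp]
  refine Finset.sum_congr rfl fun x _ => ?_
  have h1 : Tester.answer ⟨_, _, C⟩ (e x).1 (e x).2 = g x := by
    rw [← hE x ()]
    simp only [Tester.answer]
    congr 1
    funext y
    rcases y with y | y <;> simp [e, inputBit]
  have h2 : (∏ i, p θ ((e x).1 i)) = ∏ i, p θ (x.1 i) := by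
    rw [← eI.prod_comp]
    simp [e]
  rw [h1, h2]
  simp [sampleWeight]

end Sim

/-! ### Parity with noise: reducing the bias, and blocks of independent copies -/

theorem spin_eq_or (b : Bool) : spin b = 1 ∨ spin b = -1 := by
  cases b <;> simp [spin]

theorem prod_spin_eq_or {ι : Type} (s : Finset ι) (x : ι → Bool) :
    ∏ i ∈ s, spin (x i) = 1 ∨ ∏ i ∈ s, spin (x i) = -1 := by
  classical
  induction s using Finset.induction_on with
  | empty => simp
  | insert i s hi ih =>
    rw [Finset.prod_insert hi]
    rcases spin_eq_or (x i) with h | h <;> rcases ih with h' | h' <;> simp [h, h']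

/-- Parity of the bits in `S` and the label. -/
def labeledParity {n : ℕ} (S : Finset (Fin n)) (z : LabeledSample n) : ℝ :=
  spin (z none) * ∏ s ∈ S, spin (z (some s))

theorem labeledParity_eq_or {n : ℕ} (S : Finset (Fin n)) (z : LabeledSample n) :
    labeledParity S z = 1 ∨ labeledParity S z = -1 := by
  rcases spin_eq_or (z none) with h | h <;>
    rcases prod_spin_eq_or S (fun s => z (some s)) with h' | h' <;> simp [labeledParity, h, h']

theorem sparseParity_eq {n : ℕ} (η : ℝ) (S : Finset (Fin n)) (z : LabeledSample n) :
    sparseParity η S z = (1 / 2) ^ n * (1 / 2 + η * labeledParity S z) := by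
  rcases spin_eq_or (z none) with h | h <;>
    rcases prod_spin_eq_or S (fun s => z (some s)) with h' | h' <;>
      norm_num [sparseParity, labeledParity, h, h'] <;> ring

/-- The uniform law and the parities with noise. -/
def parityFamily {n : ℕ} (η : ℝ) : Option (Finset (Fin n)) → LabeledSample n → ℝ
  | none => uniformLabeled n
  | some S => sparseParity η S

theorem parityFamily_eq {n : ℕ} (η : ℝ) (θ : Option (Finset (Fin n))) (z : LabeledSample n) :
    parityFamily η θ z =
      (1 / 2) ^ n * (1 / 2 + η * θ.elim 0 fun S => labeledParity S z) := by
  cases θ with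
  | none => simp [parityFamily, uniformLabeled, pow_succ]
  | some S => simp [parityFamily, sparseParity_eq]

/-- Replace the label by a second coin if a first coin shows tails. -/
def noiseLabel {n : ℕ} (x : LabeledSample n × (Bool × Bool)) : LabeledSample n
  | none => if x.2.1 = true then x.1 none else x.2.2
  | some i => x.1 (some i)

/-- With probability `1/2` the label becomes a fair coin, which has no correlation with the parity,
so the bias is halved. The uniform law is preserved, hence both hypotheses of the testing problem
are transformed together. -/
theorem hasLaw_noiseLabel {n : ℕ} (η : ℝ) (θ : Option (Finset (Fin n))) :
    HasLaw (fun x : LabeledSample n × (Bool × Bool) =>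
      parityFamily η θ x.1 * ((1 / 2) * (1 / 2))) noiseLabel (parityFamily (η / 2) θ) := by
  intro f
  let e : Bool × (Fin n → Bool) ≃ LabeledSample n :=
    (Equiv.piOptionEquivProd (β := fun _ : Option (Fin n) => Bool)).symm
  have he : ∀ y x, e (y, x) none = y := fun y x => rfl
  have he' : ∀ y x i, e (y, x) (some i) = x i := fun y x i => rfl
  have hn : ∀ y x u v, noiseLabel (e (y, x), (u, v)) = e (if u = true then y else v, x) := by
    intro y x u v
    funext o
    cases o <;> rfl
  rw [Fintype.sum_prod_type, ← e.sum_comp, ← e.sum_comp, Fintype.sum_prod_type,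
    Fintype.sum_prod_type, Finset.sum_comm]
  conv_rhs => rw [Finset.sum_comm]
  refine Finset.sum_congr rfl fun x _ => ?_
  simp only [Fintype.sum_prod_type, Fintype.sum_bool, hn, parityFamily_eq]
  have hl : ∀ y, (θ.elim 0 fun S => labeledParity S (e (y, x))) =
      spin y * θ.elim 0 fun S => ∏ s ∈ S, spin (x s) := by
    intro y
    cases θ <;> simp [labeledParity, he, he']
  simp only [hl, spin]
  norm_num
  ring

/-- Parities with noise of bias `η / 2 ^ s` from parities with noise of bias `η`. -/
theorem exists_sim_parityFamily (η : ℝ) (s : ℕ) : ∃ K : ℕ, ∀ n : ℕ,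
    Sim (parityFamily (n := n) η) (parityFamily (η / 2 ^ s))
      (Set.range fun i (x : LabeledSample n) => x i) K := by
  induction s with
  | zero => exact ⟨0, fun n => by simpa using Sim.sample _⟩
  | succ s ih =>
    obtain ⟨K, hK⟩ := ih
    refine ⟨(2 * K + 1) * 3 + K, fun n => ?_⟩
    have hc := (Sim.coin (parityFamily (n := n) η)).mono (Nat.zero_le K)
    refine ((hK n).prod (hc.prod hc)).map noiseLabel (fun θ => ?_) ?_
    · rw [pow_succ, ← div_div]
      exact hasLaw_noiseLabel _ θ
    · rintro _ ⟨_ | i, rfl⟩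
      · exact Cost.mux (c := fun x : LabeledSample n × (Bool × Bool) => x.2.1)
          (a := fun x => x.1 none) (b := fun x => x.2.2)
          (Or.inr ⟨_, Or.inl ⟨id, rfl, rfl⟩, rfl⟩) (Or.inl ⟨_, ⟨none, rfl⟩, rfl⟩)
          (Or.inr ⟨_, Or.inr ⟨id, rfl, rfl⟩, rfl⟩)
      · exact Cost.of_mem (Or.inl ⟨_, ⟨some i, rfl⟩, rfl⟩)

/-! ### Independent blocks of labeled samples, padded with fair coins -/

section Block

variable {M m r n : ℕ}

/-- Law of `M` independent blocks with law `p` and of `r` fair coins, arranged by `E`. -/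
def blockLaw (E : (Fin M × Option (Fin m)) ⊕ Fin r ≃ Fin n) (p : LabeledSample m → ℝ)
    (x : Fin n → Bool) : ℝ :=
  (∏ b, p fun o => x (E (.inl (b, o)))) * ∏ _j : Fin r, (1 / 2 : ℝ)

/-- Arrangement of blocks and coins. -/
def blockEquiv (E : (Fin M × Option (Fin m)) ⊕ Fin r ≃ Fin n) :
    (Fin M → LabeledSample m) × (Fin r → Bool) ≃ (Fin n → Bool) :=
  (((Equiv.curry _ _ Bool).symm.prodCongr (Equiv.refl _)).trans
    (Equiv.sumArrowEquivProdArrow _ _ Bool).symm).trans (E.arrowCongr (Equiv.refl _))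

theorem blockEquiv_inl (E : (Fin M × Option (Fin m)) ⊕ Fin r ≃ Fin n)
    (x : (Fin M → LabeledSample m) × (Fin r → Bool)) (b : Fin M) (o : Option (Fin m)) :
    blockEquiv E x (E (.inl (b, o))) = x.1 b o := by
  simp [blockEquiv]
  rfl

theorem blockEquiv_inr (E : (Fin M × Option (Fin m)) ⊕ Fin r ≃ Fin n)
    (x : (Fin M → LabeledSample m) × (Fin r → Bool)) (j : Fin r) :
    blockEquiv E x (E (.inr j)) = x.2 j := by
  simp [blockEquiv]
  rfl

theorem hasLaw_blockEquiv (E : (Fin M × Option (Fin m)) ⊕ Fin r ≃ Fin n)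
    (p : LabeledSample m → ℝ) :
    HasLaw (fun x : (Fin M → LabeledSample m) × (Fin r → Bool) =>
      (∏ b, p (x.1 b)) * ∏ _j : Fin r, (1 / 2 : ℝ)) (blockEquiv E) (blockLaw E p) := by
  have := hasLaw_equiv (blockEquiv E) (blockLaw E p)
  convert this using 1
  funext x
  simp [blockLaw, blockEquiv_inl]

theorem Sim.block {Θ κ : Type} [Fintype κ] [DecidableEq κ] {p : Θ → (κ → Bool) → ℝ}
    {q : Θ → LabeledSample m → ℝ} {K : ℕ}
    (h : Sim p q (Set.range fun i (x : LabeledSample m) => x i) K)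
    (E : (Fin M × Option (Fin m)) ⊕ Fin r ≃ Fin n) :
    Sim p (fun θ => blockLaw E (q θ)) (Set.range fun i (x : Fin n → Bool) => x i) K := by
  refine ((h.pi (Fin M)).prod (((Sim.coin p).mono (Nat.zero_le K)).pi (Fin r))).map_bits
    (blockEquiv E) (fun θ => hasLaw_blockEquiv E _) ?_
  rintro _ ⟨i, rfl⟩
  obtain ⟨⟨b, o⟩ | j, rfl⟩ := E.surjective i
  · refine Or.inl ⟨fun z => z b o, ⟨b, _, ⟨o, rfl⟩, rfl⟩, ?_⟩
    funext x
    simp [blockEquiv_inl]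
  · refine Or.inr ⟨fun z => z j, ⟨j, _, rfl, rfl⟩, ?_⟩
    funext x
    simp [blockEquiv_inr]

end Block

/-! ### Comparing the masses of a data point and of a uniform point -/

section Win

variable {V : Type}

/-- Sign of `m x - m y`. -/
def massSign (m : V → ℝ) (x y : V) : ℝ := if m y < m x then 1 else if m x = m y then 0 else -1

theorem massSign_swap (m : V → ℝ) (x y : V) : massSign m y x = -massSign m x y := by
  unfold massSign
  rcases lt_trichotomy (m x) (m y) with h | h | h
  · simp [h, h.not_gt, h.ne]
  · simp [h]
  · simp [h, h.not_gt, h.ne]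

theorem abs_massSign_le (m : V → ℝ) (x y : V) : |massSign m x y| ≤ 1 := by
  unfold massSign
  split_ifs <;> simp

theorem mul_massSign (m : V → ℝ) (x y : V) : (m x - m y) * massSign m x y = |m x - m y| := by
  unfold massSign
  rcases lt_trichotomy (m x) (m y) with h | h | h
  · simp [h.not_gt, h.ne, abs_of_neg (sub_neg.2 h)]
  · simp [h]
  · simp [h, abs_of_pos (sub_pos.2 h)]

theorem massSign_div (m : V → ℝ) {Z : ℝ} (hZ : 0 < Z) :
    massSign (fun x => m x / Z) = massSign m := by
  funext x y
  simp only [massSign, div_lt_div_iff_of_pos_right hZ, div_left_inj' hZ.ne']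

variable [Fintype V]

/-- Expected sign of `m x - m y` for `x` of law `p` and `y` uniform. -/
def advantage (p m : V → ℝ) : ℝ :=
  ∑ x, p x * ∑ y, (Fintype.card V : ℝ)⁻¹ * massSign m x y

/-- Exchanging the two uniform points changes the sign. Nothing is assumed about `m`, so an
arbitrarily bad hypothesis does no harm under the uniform law. -/
theorem advantage_uniform (m : V → ℝ) :
    advantage (fun _ : V => (Fintype.card V : ℝ)⁻¹) m = 0 := by
  have h : advantage (fun _ : V => (Fintype.card V : ℝ)⁻¹) m =
      -advantage (fun _ : V => (Fintype.card V : ℝ)⁻¹) m := by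
    unfold advantage
    simp only [Finset.mul_sum]
    conv_lhs => rw [Finset.sum_comm]
    simp only [← Finset.sum_neg_distrib]
    refine Finset.sum_congr rfl fun y _ => Finset.sum_congr rfl fun x _ => ?_
    rw [massSign_swap]
    ring
  linarith

/-- The advantage is the expectation under the first law of a function bounded by `1` in absolute
value. -/
theorem abs_advantage_sub_le [Nonempty V] (p q m : V → ℝ) :
    |advantage q m - advantage p m| ≤ 2 * tvDist q p := by
  have hg : ∀ x, |∑ y, (Fintype.card V : ℝ)⁻¹ * massSign m x y| ≤ 1 := by
    intro x
    calc |∑ y, (Fintype.card V : ℝ)⁻¹ * massSign m x y|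
        ≤ ∑ y, |(Fintype.card V : ℝ)⁻¹ * massSign m x y| := Finset.abs_sum_le_sum_abs _ _
      _ ≤ ∑ _y : V, (Fintype.card V : ℝ)⁻¹ := by
          refine Finset.sum_le_sum fun y _ => ?_
          rw [abs_mul, abs_of_nonneg (by positivity)]
          exact mul_le_of_le_one_right (by positivity) (abs_massSign_le m x y)
      _ = 1 := by
          rw [Finset.sum_const, Finset.card_univ, nsmul_eq_mul]
          exact mul_inv_cancel₀ (by simp)
  unfold advantage tvDist
  rw [← Finset.sum_sub_distrib]
  calc _ ≤ ∑ x, |q x - p x| := by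
        refine (Finset.abs_sum_le_sum_abs _ _).trans (Finset.sum_le_sum fun x _ => ?_)
        rw [← sub_mul, abs_mul]
        exact mul_le_of_le_one_right (abs_nonneg _) (hg x)
    _ = _ := by ring

/-- Symmetrizing in the two points shows that twice the advantage is the sum over `x` of the mean
over `y` of `|q x - q y|`. Moving the mean over `y` inside the absolute value gives `|q x - 1 / card
V|`. -/
theorem tvDist_le_advantage [Nonempty V] (q : V → ℝ) (hq : ∑ x, q x = 1) :
    tvDist q (fun _ => (Fintype.card V : ℝ)⁻¹) ≤ advantage q q := by
  have hN : (Fintype.card V : ℝ) ≠ 0 := by simp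
  have h2 : 2 * advantage q q = (Fintype.card V : ℝ)⁻¹ * ∑ x, ∑ y, |q x - q y| := by
    have h : advantage q q = ∑ x, ∑ y, (Fintype.card V : ℝ)⁻¹ * (-(q y * massSign q x y)) := by
      unfold advantage
      simp only [Finset.mul_sum]
      rw [Finset.sum_comm]
      refine Finset.sum_congr rfl fun y _ => Finset.sum_congr rfl fun x _ => ?_
      rw [massSign_swap]
      ring
    rw [two_mul]
    nth_rw 1 [h]
    unfold advantage
    simp only [Finset.mul_sum, ← Finset.sum_add_distrib]
    refine Finset.sum_congr rfl fun x _ => Finset.sum_congr rfl fun y _ => ?_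
    rw [← mul_massSign]
    ring
  have h3 : ∀ x, |q x - (Fintype.card V : ℝ)⁻¹| ≤ (Fintype.card V : ℝ)⁻¹ * ∑ y, |q x - q y| := by
    intro x
    have : q x - (Fintype.card V : ℝ)⁻¹ = (Fintype.card V : ℝ)⁻¹ * ∑ y, (q x - q y) := by
      rw [Finset.sum_sub_distrib, hq, Finset.sum_const, Finset.card_univ, nsmul_eq_mul]
      field_simp
    rw [this, abs_mul, abs_of_nonneg (by positivity)]
    exact mul_le_mul_of_nonneg_left (Finset.abs_sum_le_sum_abs _ _) (by positivity)
  have h4 : ∑ x, |q x - (Fintype.card V : ℝ)⁻¹| ≤ 2 * advantage q q := by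
    rw [h2, Finset.mul_sum]
    exact Finset.sum_le_sum fun x _ => h3 x
  unfold tvDist
  linarith

theorem tvDist_triangle (p q r : V → ℝ) : tvDist p r ≤ tvDist p q + tvDist q r := by
  unfold tvDist
  rw [← mul_add, ← Finset.sum_add_distrib]
  exact mul_le_mul_of_nonneg_left
    (Finset.sum_le_sum fun x _ => abs_sub_le _ _ _) (by norm_num)

theorem tvDist_symm (p q : V → ℝ) : tvDist p q = tvDist q p := by
  simp only [tvDist, abs_sub_comm]

/-- A hypothesis close to a law far from uniform has an advantage. -/
theorem le_advantage [Nonempty V] (p m : V → ℝ) (hm : 0 < ∑ x, m x)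
    (hp : 0.95 ≤ tvDist p (fun _ => (Fintype.card V : ℝ)⁻¹))
    (h : tvDist (fun x => m x / ∑ y, m y) p ≤ 1 / 4) : 1 / 5 ≤ advantage p m := by
  -- The normalized hypothesis is at distance at least `0.95 - 0.25 = 0.7` from uniform. Passing
  -- from its own advantage to that under `p` costs at most `2 * 0.25`, which leaves `0.2`.
  have h1 := tvDist_le_advantage (fun x => m x / ∑ y, m y)
    (by rw [← Finset.sum_div, div_self hm.ne'])
  have h2 := abs_le.1 (abs_advantage_sub_le p (fun x => m x / ∑ y, m y)
    (fun x => m x / ∑ y, m y))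
  have h3 := tvDist_triangle p (fun x => m x / ∑ y, m y) (fun _ => (Fintype.card V : ℝ)⁻¹)
  have h4 : advantage p (fun x => m x / ∑ y, m y) = advantage p m := by
    simp only [advantage, massSign_div m hm]
  rw [h4] at h2
  have h5 := tvDist_symm p fun x => m x / ∑ y, m y
  norm_num at *
  linarith [h2.2]

/-- A data point `x` wins against a uniform point `y` if it has larger mass; ties are decided by
a coin. -/
theorem sum_win (p m : V → ℝ) (hp : ∑ x, p x = 1) [Nonempty V] [DecidablePred fun
      z : (V × V) × Bool => m z.1.2 < m z.1.1 ∨ (m z.1.1 = m z.1.2 ∧ z.2 = true)] :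
    ∑ z : (V × V) × Bool, (if m z.1.2 < m z.1.1 ∨ (m z.1.1 = m z.1.2 ∧ z.2 = true) then
      (p z.1.1 * (Fintype.card V : ℝ)⁻¹) * (1 / 2) else 0) = (1 + advantage p m) / 2 := by
  have hN : (Fintype.card V : ℝ) ≠ 0 := by simp
  have h1 : ∀ x y, (∑ t : Bool, if m y < m x ∨ (m x = m y ∧ t = true) then
      (p x * (Fintype.card V : ℝ)⁻¹) * (1 / 2) else 0) =
      p x * (Fintype.card V : ℝ)⁻¹ * (1 / 2) * (1 + massSign m x y) := by
    intro x y
    unfold massSign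
    rcases lt_trichotomy (m x) (m y) with h | h | h
    · simp [h.not_gt, h.ne]
    · simp [h]
    · simp [h]
      ring
  have h2 : ∀ x, ∑ y : V, p x * (Fintype.card V : ℝ)⁻¹ * (1 / 2) * (1 + massSign m x y) =
      p x * (1 / 2) + (1 / 2) * (p x * ∑ y, (Fintype.card V : ℝ)⁻¹ * massSign m x y) := by
    intro x
    simp only [mul_add, mul_one, Finset.sum_add_distrib, Finset.sum_const, Finset.card_univ,
      nsmul_eq_mul, Finset.mul_sum]
    congr 1
    · field_simp
    · refine Finset.sum_congr rfl fun y _ => by ring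
  rw [Fintype.sum_prod_type, Fintype.sum_prod_type]
  convert_to ∑ x, ∑ y, p x * (Fintype.card V : ℝ)⁻¹ * (1 / 2) * (1 + massSign m x y) = _
  · refine Finset.sum_congr rfl fun x _ => Finset.sum_congr rfl fun y _ => ?_
    rw [← h1]
    exact Finset.sum_congr rfl fun t _ => if_congr Iff.rfl rfl rfl
  · simp only [h2, Finset.sum_add_distrib, ← Finset.sum_mul, hp]
    rw [← Finset.mul_sum, advantage]
    ring

end Win

/-! ### Repeated trials -/

/-- A trial of `T` comparisons succeeds with probability `(1/2) ^ T` on uniform data and at least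
`2/3 * (3/5) ^ T` on structured data. The ratio grows like `(6/5) ^ T`, so for large `T` some number
`N` of trials makes a success unlikely in the first case and nearly certain in the second. -/
theorem exists_repetitions : ∃ T N : ℕ, 0 < T ∧ 0 < N ∧ (N : ℝ) * (1 / 2) ^ T ≤ 0.005 ∧
    200 ≤ 1 + (N : ℝ) * (2 / 3 * (3 / 5) ^ T) :=
  ⟨80, 4 * 10 ^ 20, by norm_num, by norm_num, by norm_num, by norm_num⟩

theorem one_sub_pow_le {x a : ℝ} {N : ℕ} (hx : 0 ≤ x) (hxa : x ≤ a) (ha : a ≤ 1)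
    (hN : 200 ≤ 1 + (N : ℝ) * x) : (1 - a) ^ N ≤ 0.005 := by
  have h1 : (1 - a) ^ N ≤ (1 - x) ^ N := pow_le_pow_left₀ (by linarith) (by linarith) N
  -- Since `(1 + x) ^ N ≥ 200` by Bernoulli, this product bound forces `(1 - x) ^ N ≤ 1 / 200`.
  have h2 : (1 - x) ^ N * (1 + x) ^ N ≤ 1 := by
    rw [← mul_pow]
    exact pow_le_one₀ (by nlinarith) (by nlinarith)
  have h3 : 1 + (N : ℝ) * x ≤ (1 + x) ^ N := one_add_mul_le_pow (by linarith) N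
  have h4 : 0 ≤ (1 - x) ^ N := pow_nonneg (by linarith) N
  nlinarith

theorem one_sub_one_sub_pow_le {a : ℝ} {N : ℕ} (ha : a ≤ 1) :
    1 - (1 - a) ^ N ≤ N * a := by
  have := one_add_mul_le_pow (a := -a) (by linarith) N
  rw [← sub_eq_add_neg] at this
  linarith

theorem law_any {N : ℕ} (r : Bool → ℝ) :
    law (fun x : Fin N → Bool => ∏ i, r (x i)) (fun x => decide (∃ i, x i = true)) false =
      r false ^ N := by
  classical
  rw [law, Finset.sum_eq_single fun _ => false]
  · simp
  · intro x _ hx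
    rw [if_neg]
    simpa [funext_iff] using hx
  · simp

/-! ### From a learner to a tester -/

section Trial

variable {n : ℕ}

/-- Sample space of a trial: the input of the learner, and `T` pairs of a data point and a uniform
point with a coin for ties. -/
abbrev TrialSpace (L : Learner n) (T : ℕ) : Type :=
  ((Fin L.samples → Fin n → Bool) × (Fin L.coins → Bool)) ×
    (Fin T → ((Fin n → Bool) × (Fin n → Bool)) × Bool)

/-- Weight of an outcome of a trial with data of law `p`. -/
def trialWeight (L : Learner n) (T : ℕ) (p : (Fin n → Bool) → ℝ) (x : TrialSpace L T) : ℝ :=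
  ((∏ i, p (x.1.1 i)) * ∏ _j : Fin L.coins, (1 / 2 : ℝ)) *
    ∏ t, ((p (x.2 t).1.1 * ∏ _i : Fin n, (1 / 2 : ℝ)) * (1 / 2))

/-- A trial succeeds if all the data points win. -/
def trialOutcome (L : Learner n) (T : ℕ) (x : TrialSpace L T) : Bool :=
  decide (∀ t, compareBits L.valLen
    (L.evaluate.eval (Sum.elim (L.hypothesis x.1.1 x.1.2) (x.2 t).1.1))
    (L.evaluate.eval (Sum.elim (L.hypothesis x.1.1 x.1.2) (x.2 t).1.2)) (x.2 t).2 = true)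

/-- The hypothesis is computed once, its mass is evaluated at `2 * T` points, and each comparison
costs four gates per digit. All of this is linear in `L.time` for fixed `T`. -/
theorem cost_trialOutcome (L : Learner n) {T : ℕ} (hT : 0 < T)
    (B : Set (TrialSpace L T → Bool))
    (h1 : ∀ i j, (fun x : TrialSpace L T => x.1.1 i j) ∈ B)
    (h2 : ∀ j, (fun x : TrialSpace L T => x.1.2 j) ∈ B)
    (h3 : ∀ t j, (fun x : TrialSpace L T => (x.2 t).1.1 j) ∈ B)
    (h4 : ∀ t j, (fun x : TrialSpace L T => (x.2 t).1.2 j) ∈ B)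
    (h5 : ∀ t, (fun x : TrialSpace L T => (x.2 t).2) ∈ B) :
    Cost {trialOutcome L T} B (10 * T * (L.time + 1)) := by
  have : Nonempty (Fin T) := ⟨⟨0, hT⟩⟩
  have hl := Cost.of_circuit L.learn (B := B)
    (Sum.elim (fun q x => x.1.1 q.1 q.2) (fun j x => x.1.2 j)) (by
      rintro (q | j)
      · exact h1 _ _
      · exact h2 _)
  set B₁ := B ∪ Set.range fun o (x : TrialSpace L T) => L.learn.eval (fun i =>
    Sum.elim (fun q (x : TrialSpace L T) => x.1.1 q.1 q.2) (fun j x => x.1.2 j) i x) o with hB₁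
  have hyp : ∀ o, (fun x : TrialSpace L T => L.hypothesis x.1.1 x.1.2 o) ∈ B₁ := by
    intro o
    refine Or.inr ⟨o, ?_⟩
    funext x
    simp only [Learner.hypothesis]
    congr 1
    funext i
    cases i <;> rfl
  let value : Fin T × Bool → Fin L.valLen → TrialSpace L T → Bool := fun tb o x =>
    L.evaluate.eval (Sum.elim (L.hypothesis x.1.1 x.1.2)
      (if tb.2 then (x.2 tb.1).1.1 else (x.2 tb.1).1.2)) o
  have he : Cost (⋃ tb, Set.range (value tb)) B₁
      (Fintype.card (Fin T × Bool) * L.evaluate.gates) := by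
    refine Cost.iUnion _ fun tb => ?_
    refine (Cost.of_circuit L.evaluate (B := B₁)
      (Sum.elim (fun o x => L.hypothesis x.1.1 x.1.2 o)
        (fun j x => (if tb.2 then (x.2 tb.1).1.1 else (x.2 tb.1).1.2) j)) ?_).mono_goal ?_
    · rintro (o | j)
      · exact hyp o
      · rcases tb with ⟨t, _ | _⟩
        · exact Or.inl (h4 t j)
        · exact Or.inl (h3 t j)
    · rintro _ ⟨o, rfl⟩
      refine ⟨o, ?_⟩
      funext x
      simp only [value]
      congr 1
      funext i
      cases i <;> rfl
  set B₂ := B₁ ∪ ⋃ tb, Set.range (value tb)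
  have hv : ∀ tb o, value tb o ∈ B₂ := fun tb o => Or.inr (Set.mem_iUnion.2 ⟨tb, o, rfl⟩)
  let win : Fin T → TrialSpace L T → Bool := fun t x =>
    compareBits L.valLen (fun o => value (t, true) o x) (fun o => value (t, false) o x) (x.2 t).2
  have hc : Cost (⋃ t, {win t}) B₂ (Fintype.card (Fin T) * (4 * L.valLen)) :=
    Cost.iUnion _ fun t => Cost.compareBits _ _ (fun x : TrialSpace L T => (x.2 t).2)
      (hv _) (hv _) (Or.inl (Or.inl (h5 t)))
  have ha : Cost {trialOutcome L T} (B₂ ∪ ⋃ t, {win t}) (Fintype.card (Fin T) + 1) := by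
    have e : trialOutcome L T = fun x => decide (∀ t, win t x = true) := by
      funext x
      simp [trialOutcome, win, value]
    rw [e]
    exact Cost.all win fun t => Or.inr (Set.mem_iUnion.2 (⟨t, rfl⟩ : ∃ t', win t ∈ {win t'}))
  refine (hl.trans (he.trans (hc.trans ha))).mono_num ?_
  simp only [Fintype.card_prod, Fintype.card_fin, Fintype.card_bool, Learner.time, Circuit.time]
  nlinarith [Nat.zero_le (T * L.learn.gates), Nat.zero_le (T * L.hypLen),
    Nat.zero_le (T * L.evaluate.gates), Nat.zero_le (T * L.valLen), hT,
    Nat.mul_le_mul_right L.learn.gates hT]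

/-! ### Success probability of a trial -/

theorem sum_pi_prod_eq_one {ι V : Type} [Fintype ι] [DecidableEq ι] [Fintype V] {p : V → ℝ}
    (hp : ∑ x, p x = 1) : ∑ s : ι → V, ∏ i, p (s i) = 1 := by
  have := Finset.prod_univ_sum (fun _ : ι => (Finset.univ : Finset V)) (fun _ x => p x)
  rw [Fintype.piFinset_univ] at this
  rw [← this, hp, Finset.prod_const_one]

theorem sum_coins_eq_one {ι : Type} [Fintype ι] [DecidableEq ι] :
    ∑ _s : ι → Bool, ∏ _i : ι, (1 / 2 : ℝ) = 1 :=
  sum_pi_prod_eq_one (p := fun _ : Bool => (1 / 2 : ℝ)) (by simp)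

theorem sum_mul_coins {ι V : Type} [Fintype ι] [DecidableEq ι] [Fintype V] (F : V → ℝ) :
    ∑ s, ∑ _u : ι → Bool, F s * ∏ _i : ι, (1 / 2 : ℝ) = ∑ s, F s := by
  simp only [← Finset.mul_sum, sum_coins_eq_one, mul_one]

theorem card_cube_inv : (Fintype.card (Fin n → Bool) : ℝ)⁻¹ = ∏ _i : Fin n, (1 / 2 : ℝ) := by
  simp

/-- Once the learner's input is fixed, the hypothesis is fixed and the `T` comparisons use fresh
independent points, so their winning probabilities multiply. -/
theorem law_trialOutcome_true (L : Learner n) (T : ℕ) (p : (Fin n → Bool) → ℝ)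
    (hp : ∑ x, p x = 1) :
    law (trialWeight L T p) (trialOutcome L T) true =
      ∑ s : Fin L.samples → Fin n → Bool, ∑ u : Fin L.coins → Bool,
        ((∏ i, p (s i)) * ∏ _j : Fin L.coins, (1 / 2 : ℝ)) *
          ((1 + advantage p (L.mass (L.hypothesis s u))) / 2) ^ T := by
  classical
  rw [law, Fintype.sum_prod_type, Fintype.sum_prod_type]
  refine Finset.sum_congr rfl fun s _ => Finset.sum_congr rfl fun u _ => ?_
  rw [← sum_win _ _ hp, card_cube_inv]
  have h := Finset.prod_univ_sum (fun _ : Fin T =>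
      (Finset.univ : Finset (((Fin n → Bool) × (Fin n → Bool)) × Bool)))
    (fun _ z => if L.mass (L.hypothesis s u) z.1.2 < L.mass (L.hypothesis s u) z.1.1 ∨
        (L.mass (L.hypothesis s u) z.1.1 = L.mass (L.hypothesis s u) z.1.2 ∧ z.2 = true) then
      (p z.1.1 * ∏ _i : Fin n, (1 / 2 : ℝ)) * (1 / 2) else 0)
  rw [Finset.prod_const, Finset.card_univ, Fintype.card_fin, Fintype.piFinset_univ] at h
  rw [h, Finset.mul_sum]
  refine Finset.sum_congr rfl fun x _ => ?_
  rw [Finset.prod_ite_zero, mul_ite, mul_zero]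
  have hiff : trialOutcome L T ((s, u), x) = true ↔ ∀ t ∈ Finset.univ,
      L.mass (L.hypothesis s u) (x t).1.2 < L.mass (L.hypothesis s u) (x t).1.1 ∨
        (L.mass (L.hypothesis s u) (x t).1.1 = L.mass (L.hypothesis s u) (x t).1.2 ∧
          (x t).2 = true) := by
    simp only [trialOutcome, decide_eq_true_eq, compareBits_eq_true, Finset.mem_univ,
      true_imp_iff, Learner.mass, Nat.cast_lt, Nat.cast_inj]
  by_cases hx : trialOutcome L T ((s, u), x) = true
  · rw [if_pos hx, if_pos (hiff.1 hx)]
    rfl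
  · rw [if_neg hx, if_neg fun h => hx (hiff.2 h)]

theorem law_true_add_law_false {Ω : Type} [Fintype Ω] (w : Ω → ℝ) (g : Ω → Bool) :
    law w g true + law w g false = ∑ x, w x := by
  have := hasLaw_law w g fun _ => 1
  simpa using this.symm

theorem sum_trialWeight (L : Learner n) (T : ℕ) (p : (Fin n → Bool) → ℝ) (hp : ∑ x, p x = 1) :
    ∑ x, trialWeight L T p x = 1 := by
  simp only [trialWeight]
  rw [Fintype.sum_prod_type]
  simp only [← Finset.mul_sum]
  rw [sum_pi_prod_eq_one (p := fun z : ((Fin n → Bool) × (Fin n → Bool)) × Bool =>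
    (p z.1.1 * ∏ _i : Fin n, (1 / 2 : ℝ)) * (1 / 2)), Fintype.sum_prod_type]
  · simp only [mul_one, sum_mul_coins]
    exact sum_pi_prod_eq_one hp
  · have h2 : ∀ a : ℝ, a * (1 / 2) + a * (1 / 2) = a := fun a => by ring
    simp only [Fintype.sum_prod_type, Fintype.sum_bool, h2, sum_mul_coins, hp]

theorem law_trialOutcome_uniform (L : Learner n) (T : ℕ) {p : (Fin n → Bool) → ℝ}
    (hp : p = fun _ => (Fintype.card (Fin n → Bool) : ℝ)⁻¹) :
    law (trialWeight L T p) (trialOutcome L T) true = (1 / 2) ^ T := by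
  have hs : ∑ x, p x = 1 := by simp [hp]
  rw [law_trialOutcome_true L T p hs]
  have ha : ∀ m, advantage p m = 0 := fun m => by rw [hp]; exact advantage_uniform m
  simp only [ha, add_zero, mul_right_comm _ _ ((1 / 2 : ℝ) ^ T), sum_mul_coins]
  rw [← Finset.sum_mul]
  rw [sum_pi_prod_eq_one hs, one_mul]

theorem le_law_trialOutcome (L : Learner n) (T : ℕ) {p : (Fin n → Bool) → ℝ}
    (hp : ∑ x, p x = 1) (hp0 : ∀ x, 0 ≤ p x)
    (hfar : 0.95 ≤ tvDist p (fun _ => (Fintype.card (Fin n → Bool) : ℝ)⁻¹))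
    (hL : L.LearnsDist p (1 / 4)) :
    2 / 3 * (3 / 5) ^ T ≤ law (trialWeight L T p) (trialOutcome L T) true := by
  classical
  rw [law_trialOutcome_true L T p hp]
  refine (mul_le_mul_of_nonneg_right hL (by positivity)).trans ?_
  simp only [prob, Finset.sum_mul]
  refine Finset.sum_le_sum fun s _ => Finset.sum_le_sum fun u _ => ?_
  have hw : 0 ≤ ∏ i, p (s i) := Finset.prod_nonneg fun i _ => hp0 _
  -- Being a winning probability, this is nonnegative for bad hypotheses too, so their contribution
  -- can be dropped.
  have hadv : 0 ≤ (1 + advantage p (L.mass (L.hypothesis s u))) / 2 := by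
    rw [← sum_win _ _ hp]
    refine Finset.sum_nonneg fun z _ => ?_
    have := hp0 z.1.1
    split_ifs <;> positivity
  split_ifs with h
  · rw [Finset.prod_const, Finset.card_univ, Fintype.card_fin]
    refine mul_le_mul_of_nonneg_left (pow_le_pow_left₀ (by norm_num) ?_ T) (by positivity)
    have := le_advantage p _ h.1 hfar h.2
    linarith
  · rw [zero_mul]
    positivity

theorem Sim.trial {Θ κ : Type} [Fintype κ] [DecidableEq κ] {p : Θ → (κ → Bool) → ℝ}
    {q : Θ → (Fin n → Bool) → ℝ} {K : ℕ}
    (h : Sim p q (Set.range fun i (x : Fin n → Bool) => x i) K) (L : Learner n) {T : ℕ}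
    (hT : 0 < T) :
    Sim p (fun θ => law (trialWeight L T (q θ)) (trialOutcome L T)) {id}
      ((2 * K + 1) * (10 * T * (L.time + 1)) + K) := by
  have hc := (Sim.coin p).mono (Nat.zero_le K)
  refine (((h.pi (Fin L.samples)).prod (hc.pi (Fin L.coins))).prod
    (((h.prod (hc.pi (Fin n))).prod hc).pi (Fin T))).map (trialOutcome L T)
      (fun θ => hasLaw_law _ _) ?_
  rintro _ rfl
  refine cost_trialOutcome L hT _ ?_ ?_ ?_ ?_ ?_
  · exact fun i j => Or.inl ⟨_, Or.inl ⟨_, ⟨i, _, ⟨j, rfl⟩, rfl⟩, rfl⟩, rfl⟩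
  · exact fun j => Or.inl ⟨_, Or.inr ⟨_, ⟨j, _, rfl, rfl⟩, rfl⟩, rfl⟩
  · exact fun t j => Or.inr ⟨_, ⟨t, _, Or.inl ⟨_, Or.inl ⟨_, ⟨j, rfl⟩, rfl⟩, rfl⟩, rfl⟩, rfl⟩
  · exact fun t j => Or.inr ⟨_, ⟨t, _, Or.inl ⟨_, Or.inr ⟨_, ⟨j, _, rfl, rfl⟩, rfl⟩, rfl⟩, rfl⟩,
      rfl⟩
  · exact fun t => Or.inr ⟨_, ⟨t, _, Or.inr ⟨_, rfl, rfl⟩, rfl⟩, rfl⟩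

/-- A learner for laws that are far from uniform and can be simulated yields a tester whose
running time is larger by a constant factor only. -/
theorem exists_tester_of_learner (K : ℕ) : ∃ C : ℕ, ∀ {m n : ℕ} {Θ : Type}
    {p : Θ → LabeledSample m → ℝ} {q : Θ → (Fin n → Bool) → ℝ},
    Sim p q (Set.range fun i (x : Fin n → Bool) => x i) K → ∀ L : Learner n,
    ∃ A : Tester m, A.time ≤ C * (L.time + 1) ∧
      ∀ θ₀ θ : Θ, (q θ₀ = fun _ => (Fintype.card (Fin n → Bool) : ℝ)⁻¹) →
        ∑ x, q θ x = 1 → (∀ x, 0 ≤ q θ x) →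
        0.95 ≤ tvDist (q θ) (fun _ => (Fintype.card (Fin n → Bool) : ℝ)⁻¹) →
        L.LearnsDist (q θ) (1 / 4) →
        prob (p θ₀) A.samples A.coins (fun s u => A.answer s u = true) +
          prob (p θ) A.samples A.coins (fun s u => A.answer s u = false) ≤ 0.01 := by
  obtain ⟨T, N, hT, hN, hTN, hNT⟩ := exists_repetitions
  refine ⟨(2 * ((2 * K + 1) * (10 * T) + K) + 1) * (N + 1) + ((2 * K + 1) * (10 * T) + K) + 1, ?_⟩
  intro m n Θ p q h L
  have : Nonempty (Fin N) := ⟨⟨0, hN⟩⟩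
  have h1 := (((h.trial L hT).pi (Fin N)).map (D := {id})
    (fun x => decide (∃ i, x i = true)) (fun θ => hasLaw_law _ _) (n := N + 1) (by
      rintro _ rfl
      have := Cost.any (fun i (x : Fin N → Bool) => x i)
        (B := {c | ∃ i, ∃ b ∈ ({id} : Set (Bool → Bool)), c = fun x : Fin N → Bool => b (x i)})
        (fun i => ⟨i, id, rfl, rfl⟩)
      rw [Fintype.card_fin] at this
      convert this
      rfl))
  obtain ⟨A, hA, hAp⟩ := h1.exists_tester
  refine ⟨A, hA.trans ?_, ?_⟩
  · have : (2 * K + 1) * (10 * T * (L.time + 1)) + K ≤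
        ((2 * K + 1) * (10 * T) + K) * (L.time + 1) := by
      have := Nat.zero_le (K * L.time)
      ring_nf at *
      omega
    generalize (2 * K + 1) * (10 * T * (L.time + 1)) + K = a at *
    generalize (2 * K + 1) * (10 * T) + K = b at *
    have h2 : 2 * a * (N + 1) ≤ 2 * (b * (L.time + 1)) * (N + 1) := by gcongr
    nlinarith [Nat.zero_le ((N + 1) * L.time)]
  · intro θ₀ θ h0 hs hpos hfar hL
    rw [hAp, hAp]
    set r : Θ → Bool → ℝ := fun θ => law (trialWeight L T (q θ)) (trialOutcome L T) with hr
    have hs0 : ∑ x, q θ₀ x = 1 := by simp [h0]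
    have hsum : ∀ θ, ∑ x, q θ x = 1 → r θ true + r θ false = 1 := fun θ hs => by
      rw [hr, law_true_add_law_false, sum_trialWeight L T _ hs]
    have hfalse : ∀ θ', ∑ x, q θ' x = 1 →
        law (fun x : Fin N → Bool => ∏ i, r θ' (x i)) (fun x => decide (∃ i, x i = true)) false =
          (1 - r θ' true) ^ N := fun θ' hs => by
      rw [law_any, ← hsum θ' hs, add_sub_cancel_left]
    have htrue : law (fun x : Fin N → Bool => ∏ i, r θ₀ (x i))
        (fun x => decide (∃ i, x i = true)) true = 1 - (1 - r θ₀ true) ^ N := by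
      have h3 := law_true_add_law_false (fun x : Fin N → Bool => ∏ i, r θ₀ (x i))
        (fun x => decide (∃ i, x i = true))
      rw [hfalse _ hs0, sum_pi_prod_eq_one (by simpa using hsum θ₀ hs0)] at h3
      linarith
    rw [hfalse θ hs, htrue]
    have hu : r θ₀ true = (1 / 2) ^ T := law_trialOutcome_uniform L T h0
    have hb : 2 / 3 * (3 / 5) ^ T ≤ r θ true := le_law_trialOutcome L T hs hpos hfar hL
    have hle : r θ true ≤ 1 := by
      have : 0 ≤ r θ false := by
        classical
        rw [hr]
        refine Finset.sum_nonneg fun x _ => ?_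
        split_ifs
        · refine mul_nonneg (mul_nonneg (Finset.prod_nonneg fun i _ => hpos _) (by positivity)) ?_
          exact Finset.prod_nonneg fun i _ =>
            mul_nonneg (mul_nonneg (hpos _) (by positivity)) (by norm_num)
        · exact le_rfl
      linarith [hsum θ hs]
    have e1 := one_sub_one_sub_pow_le (N := N) (a := r θ₀ true) (by
      rw [hu]; exact pow_le_one₀ (by norm_num) (by norm_num))
    have e2 := one_sub_pow_le (by positivity) hb hle hNT
    rw [hu] at e1 ⊢
    norm_num at *
    linarith

end Trial

/-! ### Iterated central differences of `log ∘ cosh` -/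

/-- Central difference with step `a`. -/
def centralDiff (a : ℝ) (f : ℝ → ℝ) (b : ℝ) : ℝ := f (b + a) - f (b - a)

/-- The function `log ∘ cosh`. -/
def logCosh (x : ℝ) : ℝ := Real.log (Real.cosh x)

theorem tendsto_logCosh_sub : Tendsto (fun x => logCosh x - x) atTop (nhds (-Real.log 2)) := by
  have h : ∀ x, logCosh x - x = Real.log (1 + Real.exp (-(2 * x))) - Real.log 2 := by
    intro x
    have h1 : Real.cosh x = Real.exp x * (1 + Real.exp (-(2 * x))) / 2 := by
      rw [Real.cosh_eq, mul_add, mul_one, ← Real.exp_add]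
      ring_nf
    have h2 : 0 < 1 + Real.exp (-(2 * x)) := by positivity
    rw [logCosh, h1, Real.log_div (by positivity) (by norm_num),
      Real.log_mul (Real.exp_pos x).ne' h2.ne', Real.log_exp]
    ring
  have h0 : Tendsto (fun x : ℝ => Real.exp (-(2 * x))) atTop (nhds 0) :=
    Real.tendsto_exp_neg_atTop_nhds_zero.comp (tendsto_id.const_mul_atTop (by norm_num))
  have h1 : Tendsto (fun x : ℝ => Real.log (1 + Real.exp (-(2 * x))) - Real.log 2) atTop
      (nhds (Real.log (1 + 0) - Real.log 2)) :=
    ((h0.const_add 1).log (by norm_num)).sub_const _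
  simpa [funext h] using h1

theorem tendsto_shift {f : ℝ → ℝ} {c : ℝ} (h : Tendsto f atTop (nhds c)) (a : ℝ) :
    Tendsto (fun b => f (b + a)) atTop (nhds c) :=
  h.comp (tendsto_atTop_add_const_right _ a tendsto_id)

theorem tendsto_centralDiff {f : ℝ → ℝ} {c : ℝ} (h : Tendsto f atTop (nhds c)) (a : ℝ) :
    Tendsto (centralDiff a f) atTop (nhds 0) := by
  have := (tendsto_shift h a).sub (tendsto_shift h (-a))
  rw [sub_self] at this
  exact this.congr fun b => by rw [centralDiff, sub_eq_add_neg b]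

theorem tendsto_centralDiff_logCosh (a : ℝ) :
    Tendsto (centralDiff a logCosh) atTop (nhds (2 * a)) := by
  have := ((tendsto_centralDiff tendsto_logCosh_sub a).add_const (2 * a))
  rw [zero_add] at this
  refine this.congr fun b => ?_
  simp only [centralDiff]
  ring

/-- A vanishing central difference makes `f` periodic with period `2 * a`, and a periodic function
with a limit at infinity is constant. -/
theorem eq_of_centralDiff_eq_zero {f : ℝ → ℝ} {a c : ℝ} (ha : 0 < a)
    (hf : ∀ b, centralDiff a f b = 0) (h : Tendsto f atTop (nhds c)) (b : ℝ) : f b = c := by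
  have hn : ∀ n : ℕ, f (b + n * (2 * a)) = f b := by
    intro n
    induction n with
    | zero => simp
    | succ n ih =>
      have := hf (b + n * (2 * a) + a)
      rw [centralDiff, sub_eq_zero, add_sub_cancel_right] at this
      rw [← ih, ← this]
      push_cast
      ring_nf
  have ht : Tendsto (fun n : ℕ => b + n * (2 * a)) atTop atTop :=
    tendsto_atTop_add_const_left _ b
      (tendsto_natCast_atTop_atTop.atTop_mul_const (by positivity))
  have := h.comp ht
  simp only [Function.comp_def, hn] at this
  exact tendsto_nhds_unique tendsto_const_nhds this

/-- If one more difference vanished identically, the previous one would be constant and equal to its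
limit `0`, against the induction hypothesis. The limit is carried along in the statement for this
purpose. -/
theorem exists_iterate_centralDiff_ne_zero {a : ℝ} (ha : 0 < a) (k : ℕ) :
    Tendsto ((centralDiff a)^[k + 2] logCosh) atTop (nhds 0) ∧
      ∃ b, (centralDiff a)^[k + 2] logCosh b ≠ 0 := by
  induction k with
  | zero =>
    have h1 := tendsto_centralDiff_logCosh a
    refine ⟨tendsto_centralDiff h1 a, ?_⟩
    by_contra! h
    -- The first difference would be constantly `2 * a`, but it vanishes at `0` because `logCosh` is
    -- even.
    have := eq_of_centralDiff_eq_zero ha h h1 0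
    simp [centralDiff, logCosh] at this
    exact ha.ne' this
  | succ k ih =>
    rw [show k + 1 + 2 = (k + 2) + 1 from rfl, Function.iterate_succ']
    refine ⟨tendsto_centralDiff ih.1 a, ?_⟩
    by_contra! h
    obtain ⟨b, hb⟩ := ih.2
    exact hb (eq_of_centralDiff_eq_zero ha h ih.1 b)

theorem sum_signs_eq_iterate_centralDiff (a : ℝ) (f : ℝ → ℝ) (k : ℕ) (b : ℝ) :
    ∑ τ : Fin k → Bool, (∏ i, spin (τ i)) * f (b + a * ∑ i, spin (τ i)) =
      (centralDiff a)^[k] f b := by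
  induction k generalizing b with
  | zero => simp
  | succ k ih =>
    rw [Function.iterate_succ_apply', centralDiff, ← ih, ← ih,
      ← (Fin.consEquiv fun _ : Fin (k + 1) => Bool).sum_comp, Fintype.sum_prod_type,
      Fintype.sum_bool, sub_eq_add_neg, ← Finset.sum_neg_distrib]
    simp only [Fin.consEquiv_apply, Fin.prod_univ_succ, Fin.sum_univ_succ, Fin.cons_zero,
      Fin.cons_succ, spin]
    congr 1 <;> refine Finset.sum_congr rfl fun τ _ => ?_
    · simp only [if_true, one_mul]
      ring_nf
    · simp only [Bool.false_eq_true, if_false, neg_mul, one_mul]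
      ring_nf

/-! ### The weight of a block of hidden units -/

section Factor

variable {ι ι' : Type} [Fintype ι] [DecidableEq ι] [Fintype ι'] [DecidableEq ι']

/-- Product of the factors of the hidden units with sign patterns `τ`, when the parity of the
visible units is `y`. -/
def parityFactor (ι : Type) [Fintype ι] [DecidableEq ι] (a a' b y : ℝ) : ℝ :=
  ∏ τ : ι → Bool, Real.cosh (a * ∑ i, spin (τ i) + a' * y * ∏ i, spin (τ i) + b)

theorem parityFactor_pos (a a' b y : ℝ) : 0 < parityFactor ι a a' b y :=
  Finset.prod_pos fun _ _ => Real.cosh_pos _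

theorem parityFactor_congr (e : ι ≃ ι') : parityFactor ι = parityFactor ι' := by
  funext a a' b y
  unfold parityFactor
  rw [← (e.arrowCongr (Equiv.refl Bool)).symm.prod_comp]
  refine Finset.prod_congr rfl fun τ _ => ?_
  have h1 : ∑ i, spin ((e.arrowCongr (Equiv.refl Bool)).symm τ i) = ∑ i, spin (τ i) :=
    e.sum_comp fun i => spin (τ i)
  have h2 : ∏ i, spin ((e.arrowCongr (Equiv.refl Bool)).symm τ i) = ∏ i, spin (τ i) :=
    e.prod_comp fun i => spin (τ i)
  rw [h1, h2]

theorem spin_beq (b c : Bool) : spin (b == c) = spin b * spin c := by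
  cases b <;> cases c <;> simp [spin]

/-- The product over the sign patterns only depends on the parity. -/
theorem prod_cosh_eq_parityFactor (a a' b : ℝ) (z : ι → Bool) (w : Bool) :
    ∏ τ : ι → Bool, Real.cosh (a * ∑ i, spin (τ i) * spin (z i) +
      a' * spin w * (∏ i, spin (τ i)) + b) =
      parityFactor ι a a' b (spin w * ∏ i, spin (z i)) := by
  -- Flipping the pattern by `z` absorbs `z` into the sum and moves `∏ i, spin (z i)` to the label
  -- term.
  let e : (ι → Bool) ≃ (ι → Bool) :=
    Function.Involutive.toPerm (fun τ i => τ i == z i) fun τ => by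
      funext i
      cases h : τ i <;> cases h' : z i <;> simp [h, h']
  have he : ∀ τ i, spin (e τ i) = spin (τ i) * spin (z i) := fun τ i => spin_beq _ _
  unfold parityFactor
  rw [← e.prod_comp]
  refine Finset.prod_congr rfl fun τ _ => ?_
  simp only [he, mul_assoc, ← Finset.prod_mul_distrib]
  have h1 : ∀ c : Bool, spin c * spin c = 1 := fun c => by cases c <;> simp [spin]
  simp only [h1, mul_one]
  have h2 : ∏ i, spin (τ i) * spin (z i) = ∏ i, spin (z i) * spin (τ i) :=
    Finset.prod_congr rfl fun i _ => mul_comm _ _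
  rw [h2]

/-- Bias of the parity when the weights are given by `parityFactor`. -/
def parityBias (ι : Type) [Fintype ι] [DecidableEq ι] (a a' b : ℝ) : ℝ :=
  (parityFactor ι a a' b 1 - parityFactor ι a a' b (-1)) /
    (2 * (parityFactor ι a a' b 1 + parityFactor ι a a' b (-1)))

theorem parityFactor_eq_bias (a a' b : ℝ) {y : ℝ} (hy : y = 1 ∨ y = -1) :
    parityFactor ι a a' b y = (parityFactor ι a a' b 1 + parityFactor ι a a' b (-1)) *
      (1 / 2 + parityBias ι a a' b * y) := by
  have h1 := parityFactor_pos (ι := ι) a a' b 1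
  have h2 := parityFactor_pos (ι := ι) a a' b (-1)
  have h3 := (add_pos h1 h2).ne'
  unfold parityBias
  rcases hy with rfl | rfl <;> field_simp <;> ring

theorem continuous_parityBias (a b : ℝ) : Continuous fun a' => parityBias ι a a' b := by
  have h : ∀ y, Continuous fun a' => parityFactor ι a a' b y := fun y =>
    continuous_finsetProd _ fun τ _ => Real.continuous_cosh.comp (by fun_prop)
  refine ((h 1).sub (h (-1))).div (continuous_const.mul ((h 1).add (h (-1)))) fun a' => ?_
  have h1 := parityFactor_pos (ι := ι) a a' b 1
  have h2 := parityFactor_pos (ι := ι) a a' b (-1)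
  positivity

theorem parityBias_neg (a a' b : ℝ) : parityBias ι a (-a') b = -parityBias ι a a' b := by
  have h : ∀ y, parityFactor ι a (-a') b y = parityFactor ι a a' b (-y) := by
    intro y
    simp [parityFactor]
  simp only [parityBias, h, neg_neg]
  rw [← neg_div, neg_sub, add_comm]

theorem parityBias_zero (a b : ℝ) : parityBias ι a 0 b = 0 := by
  simp [parityBias, parityFactor]

/-- For each pattern the two label values give a central difference with sign `∏ i, spin (τ i)`.
Summed over patterns, these signed terms are the remaining `k` differences. -/
theorem log_parityFactor_sub {k : ℕ} (a b : ℝ) :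
    Real.log (parityFactor (Fin k) a a b 1) - Real.log (parityFactor (Fin k) a a b (-1)) =
      (centralDiff a)^[k + 1] logCosh b := by
  unfold parityFactor
  rw [Real.log_prod fun τ _ => (Real.cosh_pos _).ne',
    Real.log_prod fun τ _ => (Real.cosh_pos _).ne', ← Finset.sum_sub_distrib,
    Function.iterate_succ_apply, ← sum_signs_eq_iterate_centralDiff]
  refine Finset.sum_congr rfl fun τ _ => ?_
  simp only [centralDiff, logCosh]
  rcases prod_spin_eq_or Finset.univ τ with h | h <;> rw [h] <;> ring_nf

theorem exists_parityBias_eq {k : ℕ} (hk : 1 ≤ k) {a η : ℝ} (ha : 0 < a) (hη : 0 < η) :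
    ∃ (b : ℝ) (s : ℕ) (a' : ℝ), |a'| ≤ a ∧ a' ≠ 0 ∧ parityBias (Fin k) a a' b = η / 2 ^ s := by
  obtain ⟨l, rfl⟩ : ∃ l, k = l + 1 := ⟨k - 1, by omega⟩
  obtain ⟨b, hb⟩ := (exists_iterate_centralDiff_ne_zero ha l).2
  rw [← log_parityFactor_sub] at hb
  have hne : parityBias (Fin (l + 1)) a a b ≠ 0 := by
    intro h
    have h1 := parityFactor_pos (ι := Fin (l + 1)) a a b 1
    have h2 := parityFactor_pos (ι := Fin (l + 1)) a a b (-1)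
    rw [parityBias, div_eq_zero_iff, or_iff_left (by positivity), sub_eq_zero] at h
    rw [h, sub_self] at hb
    exact hb rfl
  obtain ⟨s, hs⟩ : ∃ s : ℕ, η / 2 ^ s ≤ |parityBias (Fin (l + 1)) a a b| := by
    obtain ⟨s, hs⟩ := pow_unbounded_of_one_lt (η / |parityBias (Fin (l + 1)) a a b|)
      (one_lt_two : (1 : ℝ) < 2)
    refine ⟨s, ?_⟩
    have := abs_pos.2 hne
    rw [div_lt_iff₀ this] at hs
    rw [div_le_iff₀ (by positivity), mul_comm]
    exact hs.le
  have hpos : 0 < η / 2 ^ s := by positivity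
  -- The bias is odd in `a'`, so on `[-a, a]` it takes every value between its two opposite endpoint
  -- values, whatever their signs.
  have key : ∃ a' ∈ Set.uIcc (-a) a, parityBias (Fin (l + 1)) a a' b = η / 2 ^ s := by
    refine intermediate_value_uIcc (continuous_parityBias a b).continuousOn ?_
    rw [parityBias_neg, Set.mem_uIcc]
    rcases abs_cases (parityBias (Fin (l + 1)) a a b) with h | h
    · left; constructor <;> linarith
    · right; constructor <;> linarith
  obtain ⟨a', ha', h⟩ := key
  rw [Set.uIcc_of_le (by linarith)] at ha'
  refine ⟨b, s, a', abs_le.2 ha', ?_, h⟩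
  rintro rfl
  rw [parityBias_zero] at h
  linarith

end Factor

/-! ### Total variation distance of the blocks from the uniform law -/

theorem sum_labeled {m : ℕ} (S : Finset (Fin m)) (A B : ℝ) :
    ∑ z : LabeledSample m, (1 / 2 : ℝ) ^ m * (A + B * labeledParity S z) = 2 * A := by
  let e : Bool × (Fin m → Bool) ≃ LabeledSample m :=
    (Equiv.piOptionEquivProd (β := fun _ : Option (Fin m) => Bool)).symm
  have he : ∀ y x, labeledParity S (e (y, x)) = spin y * ∏ s ∈ S, spin (x s) := fun y x => rfl
  rw [← e.sum_comp, Fintype.sum_prod_type]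
  simp only [he, Fintype.sum_bool, ← Finset.sum_add_distrib]
  have h : ∀ x : Fin m → Bool, (1 / 2 : ℝ) ^ m * (A + B * (spin true * ∏ s ∈ S, spin (x s))) +
      (1 / 2 : ℝ) ^ m * (A + B * (spin false * ∏ s ∈ S, spin (x s))) = (1 / 2) ^ m * (2 * A) := by
    intro x
    have ht : spin true = 1 := rfl
    have hf : spin false = -1 := rfl
    rw [ht, hf]
    ring
  rw [Finset.sum_congr rfl fun x _ => h x]
  simp [← mul_assoc]

theorem sum_sparseParity {m : ℕ} (η : ℝ) (S : Finset (Fin m)) : ∑ z, sparseParity η S z = 1 := by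
  simp only [sparseParity_eq, sum_labeled]
  norm_num

theorem sparseParity_zero {m : ℕ} (S : Finset (Fin m)) :
    sparseParity 0 S = uniformLabeled m := by
  funext z
  simp [sparseParity_eq, uniformLabeled, pow_succ]

theorem sparseParity_nonneg {m : ℕ} {η : ℝ} (h0 : 0 ≤ η) (h1 : η ≤ 1 / 2) (S : Finset (Fin m))
    (z : LabeledSample m) : 0 ≤ sparseParity η S z := by
  unfold sparseParity
  refine mul_nonneg (by positivity) ?_
  split_ifs <;> linarith

section Block

variable {M m r n : ℕ} (E : (Fin M × Option (Fin m)) ⊕ Fin r ≃ Fin n)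

theorem sum_blockLaw (p : LabeledSample m → ℝ) : ∑ x, blockLaw E p x = (∑ z, p z) ^ M := by
  have h := hasLaw_blockEquiv E p fun _ => 1
  simp only [mul_one] at h
  rw [← h, Fintype.sum_prod_type, sum_mul_coins fun x : Fin M → LabeledSample m => ∏ b, p (x b)]
  have := Finset.prod_univ_sum (fun _ : Fin M => (Finset.univ : Finset (LabeledSample m)))
    (fun _ x => p x)
  rw [Fintype.piFinset_univ] at this
  rw [← this, Finset.prod_const, Finset.card_univ, Fintype.card_fin]

theorem blockLaw_nonneg {p : LabeledSample m → ℝ} (hp : ∀ z, 0 ≤ p z) (x : Fin n → Bool) :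
    0 ≤ blockLaw E p x :=
  mul_nonneg (Finset.prod_nonneg fun _ _ => hp _) (by positivity)

theorem blockLaw_uniform :
    blockLaw E (uniformLabeled m) = fun _ => (Fintype.card (Fin n → Bool) : ℝ)⁻¹ := by
  have hn : n = M * (m + 1) + r := by simpa using (Fintype.card_congr E).symm
  funext x
  rw [card_cube_inv]
  simp only [blockLaw, uniformLabeled, Finset.prod_const, Finset.card_univ, Fintype.card_fin]
  rw [← pow_mul, ← pow_add, hn]
  ring_nf

/-- This makes the Bhattacharyya coefficient multiplicative over blocks. The coins have the same law
on both sides and contribute a factor `1`. -/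
theorem sqrt_blockLaw_mul {p q : LabeledSample m → ℝ} (hp : ∀ z, 0 ≤ p z) (hq : ∀ z, 0 ≤ q z)
    (x : Fin n → Bool) :
    √(blockLaw E p x * blockLaw E q x) = blockLaw E (fun z => √(p z * q z)) x := by
  have hc : (0 : ℝ) ≤ ∏ _j : Fin r, (1 / 2 : ℝ) := by positivity
  have : blockLaw E p x * blockLaw E q x =
      (∏ b, (p fun o => x (E (.inl (b, o)))) * q fun o => x (E (.inl (b, o)))) *
        ((∏ _j : Fin r, (1 / 2 : ℝ)) * ∏ _j : Fin r, (1 / 2 : ℝ)) := by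
    simp only [blockLaw, Finset.prod_mul_distrib]
    ring
  rw [this, Real.sqrt_mul (Finset.prod_nonneg fun b _ => mul_nonneg (hp _) (hq _)),
    Real.sqrt_mul_self hc, Real.sqrt_prod _ fun b _ => mul_nonneg (hp _) (hq _)]
  rfl

/-- Pointwise `|p - q| = p + q - 2 * min p q`, and the minimum is at most the geometric mean. -/
theorem one_sub_le_tvDist {V : Type} [Fintype V] {p q : V → ℝ} (hp : ∀ x, 0 ≤ p x)
    (hq : ∀ x, 0 ≤ q x) (hp1 : ∑ x, p x = 1) (hq1 : ∑ x, q x = 1) :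
    1 - ∑ x, √(p x * q x) ≤ tvDist p q := by
  have h : ∀ x, p x + q x - 2 * √(p x * q x) ≤ |p x - q x| := by
    intro x
    rcases le_total (p x) (q x) with h | h
    · have : p x ≤ √(p x * q x) := Real.le_sqrt_of_sq_le (by nlinarith [hp x])
      rw [abs_of_nonpos (by linarith)]
      linarith
    · have : q x ≤ √(p x * q x) := Real.le_sqrt_of_sq_le (by nlinarith [hq x])
      rw [abs_of_nonneg (by linarith)]
      linarith
  have hs := Finset.sum_le_sum fun x (_ : x ∈ Finset.univ) => h x
  rw [Finset.sum_sub_distrib, Finset.sum_add_distrib, hp1, hq1, ← Finset.mul_sum] at hs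
  unfold tvDist
  linarith

/-- Bhattacharyya coefficient of a parity with noise of bias `ε` and the uniform law. -/
def affinity (ε : ℝ) : ℝ := √((1 / 2 + ε) * (1 / 2)) + √((1 / 2 - ε) * (1 / 2))

theorem affinity_lt_one {ε : ℝ} (h0 : 0 < ε) (h1 : ε < 1 / 2) : affinity ε < 1 := by
  have hu := Real.sq_sqrt (show 0 ≤ (1 / 2 + ε) * (1 / 2) by nlinarith)
  have hv := Real.sq_sqrt (show 0 ≤ (1 / 2 - ε) * (1 / 2) by nlinarith)
  have hlt : √((1 / 2 - ε) * (1 / 2)) < √((1 / 2 + ε) * (1 / 2)) :=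
    Real.sqrt_lt_sqrt (by nlinarith) (by nlinarith)
  unfold affinity
  nlinarith [Real.sqrt_nonneg ((1 / 2 + ε) * (1 / 2)), Real.sqrt_nonneg ((1 / 2 - ε) * (1 / 2)),
    sq_pos_of_pos (sub_pos.2 hlt)]

theorem sum_sqrt_sparseParity {ε : ℝ} (S : Finset (Fin m)) :
    ∑ z, √(sparseParity ε S z * uniformLabeled m z) = affinity ε := by
  have h : ∀ z, √(sparseParity ε S z * uniformLabeled m z) = (1 / 2 : ℝ) ^ m *
      (affinity ε / 2 + ((√((1 / 2 + ε) * (1 / 2)) - √((1 / 2 - ε) * (1 / 2))) / 2) *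
        labeledParity S z) := by
    intro z
    have hx : sparseParity ε S z * uniformLabeled m z =
        ((1 / 2 : ℝ) ^ m * (1 / 2) ^ m) * ((1 / 2 + ε * labeledParity S z) * (1 / 2)) := by
      rw [sparseParity_eq, uniformLabeled]
      ring
    rw [hx, Real.sqrt_mul (by positivity), Real.sqrt_mul_self (by positivity)]
    congr 1
    rcases labeledParity_eq_or S z with h | h <;> rw [h]
    · rw [mul_one, mul_one, affinity]
      ring
    · rw [mul_neg_one, ← sub_eq_add_neg, affinity]
      ring
  simp only [h, sum_labeled]
  ring

theorem le_tvDist_blockLaw {ε : ℝ} (h0 : 0 ≤ ε) (h1 : ε ≤ 1 / 2) (S : Finset (Fin m)) :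
    1 - affinity ε ^ M ≤ tvDist (blockLaw E (sparseParity ε S))
      (fun _ => (Fintype.card (Fin n → Bool) : ℝ)⁻¹) := by
  rw [← blockLaw_uniform E]
  have hu : ∀ z : LabeledSample m, 0 ≤ uniformLabeled m z := fun z => by
    unfold uniformLabeled; positivity
  have hs := sparseParity_nonneg h0 h1 S
  have := one_sub_le_tvDist (blockLaw_nonneg E hs) (blockLaw_nonneg E hu)
    (by rw [sum_blockLaw, sum_sparseParity, one_pow])
    (by rw [sum_blockLaw, ← sparseParity_zero S, sum_sparseParity, one_pow])
  simpa only [sqrt_blockLaw_mul E hs hu, sum_blockLaw, sum_sqrt_sparseParity] using this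

end Block

/-! ### Blocks of parities as restricted Boltzmann machines -/

/-- The field which acts on a hidden unit. -/
def RBM.field {n₁ n₂ : ℕ} (R : RBM n₁ n₂) (x : Fin n₁ → Bool) (j : Fin n₂) : ℝ :=
  (∑ i, spin (x i) * R.W i j) + R.b₂ j

theorem RBM.sum_weight {n₁ n₂ : ℕ} (R : RBM n₁ n₂) (x : Fin n₁ → Bool) :
    ∑ h, R.weight x h = Real.exp (∑ i, R.b₁ i * spin (x i)) *
      ∏ j, (2 * Real.cosh (R.field x j)) := by
  have hw : ∀ h, R.weight x h = Real.exp (∑ i, R.b₁ i * spin (x i)) *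
      ∏ j, Real.exp (R.field x j * spin (h j)) := by
    intro h
    rw [RBM.weight, ← Real.exp_sum, ← Real.exp_add]
    congr 1
    rw [Finset.sum_comm]
    simp only [RBM.field, add_mul, Finset.sum_add_distrib, Finset.sum_mul]
    ring
  simp only [hw, ← Finset.mul_sum]
  congr 1
  have hb : ∀ j, 2 * Real.cosh (R.field x j) = ∑ b : Bool, Real.exp (R.field x j * spin b) := by
    intro j
    simp [spin, Real.cosh_eq]
    ring
  simp only [hb]
  rw [Finset.prod_univ_sum, Fintype.piFinset_univ]

section Construction

variable {M m r n N k : ℕ}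

/-- Weight between a bit of a block and the hidden unit of the sign pattern `τ`. -/
def patternWeight (S : Finset (Fin m)) (a a' : ℝ) (τ : S → Bool) : Option (Fin m) → ℝ
  | none => a' * ∏ s, spin (τ s)
  | some i => if h : i ∈ S then a * spin (τ ⟨i, h⟩) else 0

/-- Weight between a visible unit and the hidden unit of the sign pattern `τ` of the block `b`. -/
def blockWeight (S : Finset (Fin m)) (a a' : ℝ) (bτ : Fin M × (S → Bool)) :
    (Fin M × Option (Fin m)) ⊕ Fin r → ℝ
  | .inl bo => if bo.1 = bτ.1 then patternWeight S a a' bτ.2 bo.2 else 0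
  | .inr _ => 0

/-- The restricted Boltzmann machine of independent blocks with parities of the bits in `S`. -/
def parityRBM (E : (Fin M × Option (Fin m)) ⊕ Fin r ≃ Fin n) (S : Finset (Fin m))
    (e : Fin M × (S → Bool) ≃ Fin N) (a a' β : ℝ) : RBM n N where
  W i j := blockWeight S a a' (e.symm j) (E.symm i)
  b₁ _ := 0
  b₂ _ := β

variable (E : (Fin M × Option (Fin m)) ⊕ Fin r ≃ Fin n) (S : Finset (Fin m))
  (e : Fin M × (S → Bool) ≃ Fin N) (a a' β : ℝ)

theorem sum_mul_blockWeight (f : (Fin M × Option (Fin m)) ⊕ Fin r → ℝ) (b : Fin M)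
    (τ : S → Bool) (F : ℝ → ℝ) (hF : F 0 = 0) :
    ∑ v, f v * F (blockWeight S a a' (b, τ) v) =
      ∑ o, f (.inl (b, o)) * F (patternWeight S a a' τ o) := by
  rw [Fintype.sum_sum_type, Fintype.sum_prod_type]
  simp only [blockWeight, hF, mul_zero, Finset.sum_const_zero, add_zero]
  rw [Finset.sum_eq_single b]
  · simp
  · intro b' _ hb'
    simp [hb', hF]
  · simp

theorem sum_dite_mem (g : S → ℝ) :
    ∑ i : Fin m, (if h : i ∈ S then g ⟨i, h⟩ else 0) = ∑ s : S, g s := by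
  rw [Finset.sum_dite, Finset.sum_const_zero, add_zero]
  refine Finset.sum_bij' (fun i _ => ⟨i.1, by simpa using i.2⟩)
    (fun s _ => ⟨s.1, by simp⟩) ?_ ?_ ?_ ?_ ?_ <;> simp

theorem field_parityRBM (x : Fin n → Bool) (b : Fin M) (τ : S → Bool) :
    (parityRBM E S e a a' β).field x (e (b, τ)) =
      a * (∑ s : S, spin (τ s) * spin (x (E (.inl (b, some s.1))))) +
        a' * spin (x (E (.inl (b, none)))) * (∏ s, spin (τ s)) + β := by
  simp only [RBM.field, parityRBM, Equiv.symm_apply_apply]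
  rw [← E.sum_comp]
  simp only [Equiv.symm_apply_apply]
  have := sum_mul_blockWeight (r := r) S a a' (fun v => spin (x (E v))) b τ id rfl
  simp only [id] at this
  rw [this, Fintype.sum_option]
  simp only [patternWeight, mul_dite, mul_zero]
  rw [sum_dite_mem S fun s => spin (x (E (.inl (b, some s.1)))) * (a * spin (τ s))]
  rw [add_left_inj, Finset.mul_sum, add_comm]
  congr 1
  · exact Finset.sum_congr rfl fun s _ => by ring
  · ring

/-- The hidden units split into blocks, and within a block the product over all sign patterns is
proportional to the parity law. Normalization removes the constant; visible units outside the blocks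
are fair coins. -/
theorem marginal_parityRBM :
    (parityRBM E S e a a' β).marginal = blockLaw E (sparseParity (parityBias S a a' β) S) := by
  set ε := parityBias S a a' β with hε
  have hw : ∃ c : ℝ, c ≠ 0 ∧ ∀ x, ∑ h, (parityRBM E S e a a' β).weight x h =
      c * blockLaw E (sparseParity ε S) x := by
    refine ⟨2 ^ N * ((parityFactor S a a' β 1 + parityFactor S a a' β (-1)) * 2 ^ m) ^ M * 2 ^ r,
      ?_, fun x => ?_⟩
    · have h1 := parityFactor_pos (ι := S) a a' β 1
      have h2 := parityFactor_pos (ι := S) a a' β (-1)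
      positivity
    · have hb : ∀ b, ∏ τ, Real.cosh ((parityRBM E S e a a' β).field x (e (b, τ))) =
          ((parityFactor S a a' β 1 + parityFactor S a a' β (-1)) * 2 ^ m) *
            sparseParity ε S fun o => x (E (.inl (b, o))) := by
        intro b
        simp only [field_parityRBM]
        rw [prod_cosh_eq_parityFactor a a' β (fun s : S => x (E (.inl (b, some s.1))))]
        have hp : spin (x (E (.inl (b, none)))) * ∏ s : S, spin (x (E (.inl (b, some s.1)))) =
            labeledParity S fun o => x (E (.inl (b, o))) := by
          rw [labeledParity, Finset.prod_coe_sort S fun i => spin (x (E (.inl (b, some i))))]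
        rw [hp, parityFactor_eq_bias _ _ _ (labeledParity_eq_or S _), sparseParity_eq, ← hε]
        have h2 : (2 : ℝ) ^ m * (1 / 2) ^ m = 1 := by rw [← mul_pow]; norm_num
        linear_combination (-(parityFactor S a a' β 1 + parityFactor S a a' β (-1)) *
          (1 / 2 + ε * labeledParity S fun o => x (E (.inl (b, o))))) * h2
      have hprod : ∏ j, Real.cosh ((parityRBM E S e a a' β).field x j) =
          ((parityFactor S a a' β 1 + parityFactor S a a' β (-1)) * 2 ^ m) ^ M *
            ∏ b, sparseParity ε S fun o => x (E (.inl (b, o))) := by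
        rw [← e.prod_comp, Fintype.prod_prod_type, Finset.prod_congr rfl fun b _ => hb b,
          Finset.prod_mul_distrib, Finset.prod_const, Finset.card_univ, Fintype.card_fin]
      have h0 : ∑ i, (parityRBM E S e a a' β).b₁ i * spin (x i) = 0 := by simp [parityRBM]
      rw [RBM.sum_weight, Finset.prod_mul_distrib, hprod, h0, Real.exp_zero, one_mul, blockLaw]
      simp only [Finset.prod_const, Finset.card_univ, Fintype.card_fin]
      have h2 : (2 : ℝ) ^ r * (1 / 2) ^ r = 1 := by rw [← mul_pow]; norm_num
      linear_combination (-(2 : ℝ) ^ N * ((parityFactor S a a' β 1 +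
        parityFactor S a a' β (-1)) * 2 ^ m) ^ M *
          ∏ b, sparseParity ε S fun o => x (E (.inl (b, o)))) * h2
  obtain ⟨c, hc, hw⟩ := hw
  funext x
  rw [RBM.marginal, hw]
  simp only [hw]
  rw [← Finset.mul_sum, sum_blockLaw, sum_sparseParity, one_pow, mul_one,
    mul_div_cancel_left₀ _ hc]

/-! ### Weights and hidden degrees of the block machine -/

theorem abs_patternWeight_le {a a' : ℝ} (ha : 0 < a) (ha' : |a'| ≤ a) (τ : S → Bool)
    (o : Option (Fin m)) : |patternWeight S a a' τ o| ≤ a := by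
  have hs : ∀ b, |spin b| = 1 := fun b => by cases b <;> simp [spin]
  cases o with
  | none => simpa [patternWeight, abs_mul, Finset.abs_prod, hs] using ha'
  | some i =>
    simp only [patternWeight]
    split_ifs
    · rw [abs_mul, hs, mul_one, abs_of_pos ha]
    · simpa using ha.le

theorem patternWeight_ne_zero_iff {a a' : ℝ} (ha : a ≠ 0) (ha' : a' ≠ 0) (τ : S → Bool)
    (o : Option (Fin m)) : patternWeight S a a' τ o ≠ 0 ↔ o ∈ Finset.insertNone S := by
  have hs : ∀ b, spin b ≠ 0 := fun b => by cases b <;> simp [spin]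
  cases o with
  | none => simp [patternWeight, ha', Finset.prod_eq_zero_iff, hs]
  | some i =>
    simp only [patternWeight]
    split_ifs with h <;> simp [h, ha, hs]

theorem hiddenDegree_parityRBM {a a' : ℝ} (ha : a ≠ 0) (ha' : a' ≠ 0) (j : Fin N) :
    (parityRBM E S e a a' β).hiddenDegree j = S.card + 1 := by
  obtain ⟨⟨b, τ⟩, rfl⟩ := e.surjective j
  have hinj : Function.Injective fun o => E (.inl (b, o)) := fun o o' h => by simpa using h
  have : {i | (parityRBM E S e a a' β).W i (e (b, τ)) ≠ 0} =
      (fun o => E (.inl (b, o))) '' (Finset.insertNone S : Set (Option (Fin m))) := by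
    ext i
    obtain ⟨v, rfl⟩ := E.surjective i
    rcases v with ⟨b', o⟩ | l
    · simp only [parityRBM, Equiv.symm_apply_apply, blockWeight, Set.mem_ofPred_eq]
      by_cases hb : b' = b
      · subst hb
        rw [if_pos rfl, patternWeight_ne_zero_iff S ha ha', hinj.mem_set_image, Finset.mem_coe]
      · simp [hb, Ne.symm hb]
    · simp [parityRBM, blockWeight]
  rw [RBM.hiddenDegree, this, Set.ncard_image_of_injective _ hinj, Set.ncard_coe_finset,
    Finset.card_insertNone]

theorem abs_tanh_le (x : ℝ) : |Real.tanh x| ≤ 2 * |x| := by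
  have h : ∀ y : ℝ, 0 ≤ y → |Real.tanh y| ≤ 2 * y := by
    intro y hy
    have h1 : 0 ≤ Real.sinh y := Real.sinh_nonneg_iff.2 hy
    rw [Real.tanh_eq_sinh_div_cosh, abs_of_nonneg (div_nonneg h1 (Real.cosh_pos y).le),
      div_le_iff₀ (Real.cosh_pos y), Real.sinh_eq, Real.cosh_eq]
    have h2 := Real.add_one_le_exp (-(2 * y))
    have h3 : Real.exp (-y) = Real.exp (-(2 * y)) * Real.exp y := by
      rw [← Real.exp_add]; ring_nf
    have h4 := Real.exp_pos y
    have h5 := Real.exp_pos (-y)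
    nlinarith
  rcases le_total 0 x with hx | hx
  · rw [abs_of_nonneg hx]
    exact h x hx
  · have := h (-x) (by linarith)
    rwa [Real.tanh_neg, abs_neg, ← abs_of_nonpos hx] at this

/-- A visible unit meets at most the `2 ^ S.card` hidden units of its block, and a hidden unit meets
`S.card` bits and the label, all with weights at most `a`. -/
theorem bounded_parityRBM {a a' : ℝ} (ha : 0 < a) (ha' : |a'| ≤ a)
    (h : 2 ^ S.card * (2 * ((S.card + 1) * a)) ≤ 1) :
    (parityRBM E S e a a' β).Bounded 1 1 := by
  have hk : (0 : ℝ) ≤ S.card := by positivity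
  have hp : (1 : ℝ) ≤ 2 ^ S.card := one_le_pow₀ (by norm_num)
  constructor
  · intro i
    obtain ⟨v, rfl⟩ := E.surjective i
    simp only [parityRBM, Equiv.symm_apply_apply, abs_zero, add_zero]
    rw [← e.sum_comp]
    simp only [Equiv.symm_apply_apply, Fintype.sum_prod_type]
    rcases v with ⟨b, o⟩ | l
    · rw [Finset.sum_eq_single b]
      · calc ∑ τ, |Real.tanh (blockWeight S a a' (b, τ) (.inl (b, o) : _ ⊕ Fin r))|
            ≤ ∑ _τ : S → Bool, 2 * a := by
              refine Finset.sum_le_sum fun τ _ => (abs_tanh_le _).trans ?_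
              simp only [blockWeight, if_true]
              linarith [abs_patternWeight_le S ha ha' τ o]
          _ = 2 ^ S.card * (2 * a) := by simp
          _ ≤ 1 := by nlinarith [mul_nonneg (mul_nonneg (by linarith : (0:ℝ) ≤ 2 ^ S.card) hk) ha.le]
      · intro b' _ hb'
        simp [blockWeight, hb'.symm]
      · simp
    · simp [blockWeight]
  · intro j
    obtain ⟨⟨b, τ⟩, rfl⟩ := e.surjective j
    simp only [parityRBM, Equiv.symm_apply_apply]
    rw [← E.sum_comp]
    simp only [Equiv.symm_apply_apply]
    have h1 := sum_mul_blockWeight (r := r) S a a' (fun _ => 1) b τ abs abs_zero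
    simp only [one_mul] at h1
    rw [h1]
    calc ∑ o, |patternWeight S a a' τ o| = ∑ o ∈ Finset.insertNone S, |patternWeight S a a' τ o| := by
          symm
          refine Finset.sum_subset (Finset.subset_univ _) fun o _ ho => ?_
          cases o with
          | none => simp at ho
          | some i =>
            have : i ∉ S := by simpa using ho
            simp [patternWeight, this]
      _ ≤ ∑ _o ∈ Finset.insertNone S, a := Finset.sum_le_sum fun o _ => abs_patternWeight_le S ha ha' τ o
      _ = (S.card + 1) * a := by simp
      _ ≤ 1 := by nlinarith [mul_nonneg hk ha.le]

end Construction

/-! ### The reduction from parity with noise to learning -/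

/-- The bounded restricted Boltzmann machines with `n` visible units, at most `n` hidden units and
maximum hidden degree `d`. -/
def boundedRBMs (lam₁ lam₂ : ℝ) (n d : ℕ) : Set (Σ n₂ : ℕ, RBM n n₂) :=
  {R | R.1 ≤ n ∧ R.2.maxHiddenDegree = d ∧ R.2.Bounded lam₁ lam₂}

theorem exists_reduction {η : ℝ} (hη : 0 < η) (hη' : η < 1 / 2) {k : ℕ} (hk : 1 ≤ k) :
    ∃ M C : ℕ, 0 < M ∧ ∀ m n : ℕ, M * (m + 1) ≤ n → M * 2 ^ k ≤ n → ∀ L : Learner n,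
      L.Learns (boundedRBMs 1 1 n (k + 1)) (1 / 4) →
        ∃ A : Tester m, A.Solves η k ∧ A.time ≤ C * (L.time + 1) := by
  -- The weight for which the condition of `bounded_parityRBM` is an equality.
  set a : ℝ := (2 ^ k * (2 * ((k : ℝ) + 1)))⁻¹ with ha
  have ha0 : 0 < a := by positivity
  obtain ⟨b, s, a', ha', ha'0, hbias⟩ := exists_parityBias_eq hk ha0 hη
  set ε := η / 2 ^ s with hε
  have hε0 : 0 < ε := by positivity
  have hε1 : ε < 1 / 2 :=
    (div_le_self hη.le (one_le_pow₀ (by norm_num))).trans_lt hη'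
  -- Enough blocks for distance `0.95` from uniform. The number depends on `η` and `k` but not on
  -- `m` or `n`.
  obtain ⟨M, hM⟩ := exists_pow_lt_of_lt_one (show (0 : ℝ) < 0.05 by norm_num)
    (affinity_lt_one hε0 hε1)
  have hM0 : 0 < M := by
    rcases Nat.eq_zero_or_pos M with rfl | h
    · norm_num at hM
    · exact h
  obtain ⟨K, hK⟩ := exists_sim_parityFamily η s
  obtain ⟨C, hC⟩ := exists_tester_of_learner K
  refine ⟨M, C, hM0, fun m n hmn hkn L hL => ?_⟩
  have E : (Fin M × Option (Fin m)) ⊕ Fin (n - M * (m + 1)) ≃ Fin n :=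
    Fintype.equivOfCardEq (by simp; omega)
  obtain ⟨A, hA, hAp⟩ := hC ((hK m).block E) L
  refine ⟨A, fun S hS => ?_, hA⟩
  have e : Fin M × (S → Bool) ≃ Fin (M * 2 ^ k) :=
    Fintype.equivOfCardEq (by simp [hS])
  have : Nonempty (Fin (M * 2 ^ k)) := ⟨⟨0, by positivity⟩⟩
  have hmem : (⟨M * 2 ^ k, parityRBM E S e a a' b⟩ : Σ n₂ : ℕ, RBM n n₂) ∈
      boundedRBMs 1 1 n (k + 1) := by
    refine ⟨hkn, ?_, bounded_parityRBM E S e b ha0 ha' ?_⟩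
    · rw [RBM.maxHiddenDegree, funext (hiddenDegree_parityRBM E S e b ha0.ne' ha'0), hS]
      exact Finset.sup_const Finset.univ_nonempty _
    · rw [hS, ← mul_assoc 2, ← mul_assoc, ha, mul_inv_cancel₀ (by positivity)]
  have hlearn := hL _ hmem
  have hb : parityBias S a a' b = ε := by
    rw [← hbias, parityBias, parityBias, parityFactor_congr (S.equivFinOfCardEq hS)]
  rw [marginal_parityRBM, hb] at hlearn
  refine hAp none (some S) (blockLaw_uniform E) ?_ ?_ ?_ hlearn
  · exact (sum_blockLaw E _).trans (by rw [parityFamily, sum_sparseParity, one_pow])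
  · exact blockLaw_nonneg E (sparseParity_nonneg hε0.le hε1.le S)
  · refine le_trans ?_ (le_tvDist_blockLaw E hε0.le hε1.le S)
    norm_num at hM ⊢
    linarith

/-- A fast learner for infinitely many `n` yields a fast tester for infinitely many `m`. -/
theorem frequently_exists_tester {η : ℝ} (hη : 0 < η) (hη' : η < 1 / 2) {k : ℕ} (hk : 1 ≤ k)
    {c : ℝ} (hc : 0 < c) (h : ∃ᶠ n : ℕ in atTop, ∃ L : Learner n,
      L.Learns (boundedRBMs 1 1 n (k + 1)) (1 / 4) ∧ (L.time : ℝ) < (n : ℝ) ^ (c * (k + 1 : ℝ))) :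
    ∃ᶠ m : ℕ in atTop, k ^ 4 ≤ m ∧ ∃ A : Tester m, A.Solves η k ∧
      (A.time : ℝ) < (m : ℝ) ^ (6 * c * k) := by
  obtain ⟨M, C, hM, hred⟩ := exists_reduction hη hη' hk
  have hexp : 0 < c * (k + 1 : ℝ) := by positivity
  have hlim : Tendsto (fun m : ℕ => (m : ℝ) ^ (c * (k + 1 : ℝ))) atTop atTop :=
    (tendsto_rpow_atTop hexp).comp tendsto_natCast_atTop_atTop
  obtain ⟨m₁, hm₁⟩ := eventually_atTop.1 (hlim.eventually_gt_atTop (2 * (C : ℝ)))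
  rw [frequently_atTop] at h ⊢
  intro m₀
  -- With `m = n / M - 1`, this size gives `m ≥ m₀`, `m ≥ m₁`, `m ≥ k ^ 4`, `m ≥ 3 * M` and room for
  -- `M * 2 ^ k` hidden units. Then `n ≤ m ^ 2`, which doubles the exponent; absorbing `2 * C` adds
  -- one more copy, and `3 * (k + 1) ≤ 6 * k`.
  obtain ⟨n, hn, L, hL, hLt⟩ := h (M * (m₀ + m₁ + k ^ 4 + 3 * M + 2 ^ k + 1))
  have hq : m₀ + m₁ + k ^ 4 + 3 * M + 2 ^ k + 1 ≤ n / M := by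
    rw [Nat.le_div_iff_mul_le hM, mul_comm]
    exact hn
  have h2k : 0 < 2 ^ k := by positivity
  obtain ⟨m, hm⟩ : ∃ m, n / M = m + 1 := ⟨n / M - 1, by omega⟩
  have hmn : M * (m + 1) ≤ n := hm ▸ Nat.mul_div_le n M
  have hnm : n < M * (m + 2) := by
    have := Nat.lt_mul_div_succ n hM
    rwa [hm] at this
  have hkn : M * 2 ^ k ≤ n := le_trans (Nat.mul_le_mul_left M (by omega)) hmn
  obtain ⟨A, hA, hAt⟩ := hred m n hmn hkn L hL
  refine ⟨m, by omega, by omega, A, hA, ?_⟩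
  have hm1 : 1 ≤ m := by omega
  have hnsq : n ≤ m ^ 2 := by
    have : 3 * M ≤ m := by omega
    nlinarith
  have hn1 : 1 ≤ n := by nlinarith
  have hmR : (1 : ℝ) ≤ m := by exact_mod_cast hm1
  have hp : 1 ≤ (n : ℝ) ^ (c * (k + 1 : ℝ)) :=
    Real.one_le_rpow (by exact_mod_cast hn1) hexp.le
  have hC : 2 * (C : ℝ) < (m : ℝ) ^ (c * (k + 1 : ℝ)) := hm₁ m (by omega)
  have hn2 : (n : ℝ) ^ (c * (k + 1 : ℝ)) ≤ ((m : ℝ) ^ (c * (k + 1 : ℝ))) ^ 2 := by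
    have : (n : ℝ) ≤ (m : ℝ) ^ 2 := by exact_mod_cast hnsq
    calc (n : ℝ) ^ (c * (k + 1 : ℝ)) ≤ ((m : ℝ) ^ 2) ^ (c * (k + 1 : ℝ)) :=
          Real.rpow_le_rpow (by positivity) this hexp.le
      _ = ((m : ℝ) ^ (c * (k + 1 : ℝ))) ^ 2 := by
          rw [← Real.rpow_natCast, ← Real.rpow_natCast, ← Real.rpow_mul (by positivity),
            ← Real.rpow_mul (by positivity), mul_comm]
  calc (A.time : ℝ) ≤ C * (L.time + 1) := by exact_mod_cast hAt
    _ ≤ 2 * C * (n : ℝ) ^ (c * (k + 1 : ℝ)) := by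
        have : (0 : ℝ) ≤ C := by positivity
        nlinarith
    _ < (m : ℝ) ^ (c * (k + 1 : ℝ)) * (n : ℝ) ^ (c * (k + 1 : ℝ)) :=
        mul_lt_mul_of_pos_right hC (by linarith)
    _ ≤ (m : ℝ) ^ (c * (k + 1 : ℝ)) * ((m : ℝ) ^ (c * (k + 1 : ℝ))) ^ 2 :=
        mul_le_mul_of_nonneg_left hn2 (by positivity)
    _ = (m : ℝ) ^ (c * (k + 1 : ℝ) * 3) := by
        rw [Real.rpow_mul (by positivity) _ 3]
        norm_cast
        ring
    _ ≤ (m : ℝ) ^ (6 * c * k) := by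
        refine Real.rpow_le_rpow_of_exponent_le hmR ?_
        have : (1 : ℝ) ≤ k := by exact_mod_cast hk
        nlinarith

/-- Hardness of parity with noise for all sequences of sparsities gives a lower bound with an
exponent that is uniform in the sparsity. -/
theorem SparseParityHard.exists_not_frequently {η : ℝ} (h : SparseParityHard η) :
    ∃ j : ℕ, ∀ k : ℕ, 1 ≤ k → ¬ ∃ᶠ m : ℕ in atTop, k ^ 4 ≤ m ∧ ∃ A : Tester m, A.Solves η k ∧
      (A.time : ℝ) < (m : ℝ) ^ (6 * (1 / ((j : ℝ) + 1)) * k) := by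
  classical
  by_contra! hcon
  choose k hk hfreq using hcon
  -- If no exponent works for all sparsities, each `j` has a sparsity `k j` with testers of exponent
  -- `6 / (j + 1) * k j` at infinitely many sizes. Strictly increasing sizes `φ j` place all of
  -- these on one sequence `K`, and `k j ^ 4 ≤ φ j` keeps `K n ≤ n ^ (1/4)`.
  obtain ⟨φ, hφ, hP⟩ := extraction_forall_of_frequently hfreq
  let K : ℕ → ℕ := fun n => if h : ∃ j, φ j = n then k h.choose else 1
  have hKφ : ∀ j, K (φ j) = k j := by
    intro j
    have hj : ∃ i, φ i = φ j := ⟨j, rfl⟩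
    simp only [K, dif_pos hj]
    rw [hφ.injective hj.choose_spec]
  have hK1 : ∀ n, 1 ≤ K n := by
    intro n
    simp only [K]
    split_ifs
    · exact hk _
    · exact le_rfl
  have hK4 : ∀ n, 1 ≤ n → K n ^ 4 ≤ n := by
    intro n hn
    by_cases hj : ∃ j, φ j = n
    · obtain ⟨j, rfl⟩ := hj
      rw [hKφ]
      exact (hP j).1
    · simpa [K, dif_neg hj] using hn
  have hlit : (fun n : ℕ => (K n : ℝ)) =o[atTop] fun n : ℕ => (n : ℝ) ^ (1 - 1 / 2 : ℝ) := by
    have h1 : (fun n : ℕ => (K n : ℝ)) =O[atTop] fun n : ℕ => (n : ℝ) ^ (1 / 4 : ℝ) := by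
      refine IsBigO.of_bound 1 ((eventually_ge_atTop 1).mono fun n hn => ?_)
      rw [one_mul, Real.norm_of_nonneg (by positivity), Real.norm_of_nonneg (by positivity)]
      have h4 : ((K n : ℝ)) ^ 4 ≤ n := by exact_mod_cast hK4 n hn
      calc (K n : ℝ) = ((K n : ℝ) ^ 4) ^ (1 / 4 : ℝ) := by
            rw [← Real.rpow_natCast, ← Real.rpow_mul (by positivity)]
            norm_num
        _ ≤ (n : ℝ) ^ (1 / 4 : ℝ) := Real.rpow_le_rpow (by positivity) h4 (by norm_num)
    have h2 : (fun x : ℝ => x ^ (1 / 4 : ℝ)) =o[atTop] fun x : ℝ => x ^ (1 - 1 / 2 : ℝ) := by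
      refine isLittleO_of_tendsto' ((eventually_gt_atTop 0).mono fun x hx h =>
        absurd h (Real.rpow_pos_of_pos hx _).ne') ?_
      refine (tendsto_rpow_neg_atTop (show (0 : ℝ) < 1 / 4 by norm_num)).congr' ?_
      filter_upwards [eventually_gt_atTop 0] with x hx
      rw [← Real.rpow_sub hx]
      norm_num
    exact h1.trans_isLittleO (h2.comp_tendsto tendsto_natCast_atTop_atTop)
  obtain ⟨c, hc, hev⟩ := h (1 / 2) (by norm_num) K hK1 hlit
  have hev' := hφ.tendsto_atTop.eventually hev
  -- For such `j` the exponent `6 / (j + 1)` is at most the constant `c` of the sequence `K`, which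
  -- contradicts the lower bound at size `φ j`.
  have hlarge : ∀ᶠ j : ℕ in atTop, 6 / c ≤ (j : ℝ) :=
    tendsto_natCast_atTop_atTop.eventually_ge_atTop _
  obtain ⟨j, hj, hjc⟩ := (hev'.and hlarge).exists
  obtain ⟨h4, A, hA, hAt⟩ := hP j
  have hle := hj A (by rw [hKφ]; exact hA)
  rw [hKφ] at hle
  have hφ1 : (1 : ℝ) ≤ φ j := by
    exact_mod_cast (Nat.one_le_pow 4 _ (hk j)).trans h4
  have hjc' : 6 * (1 / ((j : ℝ) + 1)) ≤ c := by
    rw [div_le_iff₀ hc] at hjc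
    rw [mul_one_div, div_le_iff₀ (by positivity)]
    nlinarith
  have := Real.rpow_le_rpow_of_exponent_le hφ1
    (mul_le_mul_of_nonneg_right hjc' (Nat.cast_nonneg (k j)))
  linarith

end RBMHardness

theorem mainTheorem10 :
    ∃ (lam₁ lam₂ : ℝ) (F : (n : ℕ) → ℕ → Set (Σ n₂ : ℕ, RBMHardness.RBM n n₂)),
      (∀ n d : ℕ, ∀ R ∈ F n d,
        R.1 ≤ n ∧ R.2.maxHiddenDegree = d ∧ R.2.Bounded lam₁ lam₂) ∧
      ∀ η : ℝ, 0 < η → η < 1 / 2 → RBMHardness.SparseParityHard η →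
        ∃ c : ℝ, 0 < c ∧ ∀ d : ℕ, 2 ≤ d → ∀ᶠ n : ℕ in Filter.atTop,
          ∀ L : RBMHardness.Learner n, L.Learns (F n d) (1 / 4) →
            (n : ℝ) ^ (c * (d : ℝ)) ≤ (L.time : ℝ) := by
  refine ⟨1, 1, RBMHardness.boundedRBMs 1 1, fun n d R hR => hR, fun η hη hη' hard => ?_⟩
  obtain ⟨j, hj⟩ := hard.exists_not_frequently
  refine ⟨1 / ((j : ℝ) + 1), by positivity, fun d hd => ?_⟩
  -- Hidden units see the `k` parity bits and the label, hence degree `k + 1`; `2 ≤ d` gives `1 ≤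
  -- k`.
  obtain ⟨k, rfl⟩ : ∃ k, d = k + 1 := ⟨d - 1, by omega⟩
  by_contra hn
  rw [Filter.not_eventually] at hn
  refine hj k (by omega) (RBMHardness.frequently_exists_tester hη hη' (by omega) (by positivity)
    (hn.mono fun n hn => ?_))
  push Not at hn
  simpa using hn

end
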